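/- A finite sequence $\mathbf k=(k_1,\dots,k_r)$ of positive integers with $r\ge 1$ is called an admissible index if $k_r\ge 2$; its depth is $r$ and its weight is $k_1+\cdots+k_r$. For an admissible index, the multiple $T$-value (MTV) of depth $r$ is $$T(k_1,\dots,k_r)=2^r\sum_{\substack{0<m_1<\cdots<m_r\\ m_i\equiv i\ (\mathrm{mod}\ 2)}}\frac{1}{m_1^{k_1}\cdots m_r^{k_r}}.$$ Theorem (parity result). Let $\mathbf k=(k_1,\dots,k_r)$ be an admissible index of depth $r\ge 2$ whose depth and weight are of different parity. Then $T(\mathbf k)$ is a $\mathbb Q$-linear combination of MTVs of depth less than $r$ and of products of two or more MTVs (each of depth at least $1$) whose depths sum to at most $r$. Moreover, in depth $2$ one has the following explicit formula: for all integers $p\ge 1$ and $q\ge 2$ with $p+q$ odd, $$(-1)^q\,T(p,q)=\binom{p+q-1}{q}T(p+q)-\sum_{\substack{1\le\mu\le q-2\\ \mu\equiv q\ (\mathrm{mod}\ 2)}}\binom{p+\mu-1}{\mu}\frac{1}{2^{q-\mu}-1}\,T(p+\mu)\,T(q-\mu)-\sum_{\substack{0\le\mu\le p-2\\ \mu\equiv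 p\ (\mathrm{mod}\ 2)}}\binom{q+\mu-1}{\mu}\,T(p-\mu)\,T(q+\mu).$$ -/

import Mathlib

namespace MTV

/-- The depth of an index `(k₁, …, k_r)`, written as a list: its number of entries `r`. -/
def depth (k : List ℕ) : ℕ := k.length

/-- The weight of an index `(k₁, …, k_r)`: the sum `k₁ + ⋯ + k_r`. -/
def weight (k : List ℕ) : ℕ := k.sum

/-- An index `(k₁, …, k_r)` of positive integers, with `r ≥ 1`, is admissible if `k_r ≥ 2`. -/
def Admissible (k : List ℕ) : Prop :=
  (∀ a ∈ k, 1 ≤ a) ∧ ∃ h : k ≠ [], 2 ≤ k.getLast h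

/-- The tuples `0 < m₁ < ⋯ < m_r` of integers with `m_i ≡ i (mod 2)` for `i = 1, …, r`;
the position `i` of the mathematical text is `(i : ℕ) + 1` for `i : Fin r`. -/
def summationSet (r : ℕ) : Set (Fin r → ℕ) :=
  {m | (∀ i, 0 < m i) ∧ StrictMono m ∧ ∀ i : Fin r, m i ≡ (i : ℕ) + 1 [MOD 2]}

/-- The multiple `T`-value
`T(k₁, …, k_r) = 2 ^ r * ∑ 1 / (m₁ ^ k₁ ⋯ m_r ^ k_r)`,
summed over all `0 < m₁ < ⋯ < m_r` with `m_i ≡ i (mod 2)`. -/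
noncomputable def T (k : List ℕ) : ℝ :=
  2 ^ k.length *
    ∑' m : summationSet k.length, ∏ i : Fin k.length, 1 / ((m.1 i : ℝ) ^ k.get i)

/-- The multiple `T`-values of depth less than `r` (and at least `1`). -/
def lowerDepthValues (r : ℕ) : Set ℝ :=
  {x | ∃ k : List ℕ, Admissible k ∧ depth k < r ∧ x = T k}

/-- The products of two or more multiple `T`-values (each of depth at least `1`) whose depths
add up to at most `r`. -/
def productValues (r : ℕ) : Set ℝ :=
  {x | ∃ L : List (List ℕ), 2 ≤ L.length ∧ (∀ k ∈ L, Admissible k) ∧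
    (L.map depth).sum ≤ r ∧ x = (L.map T).prod}

end MTV

/-!
Reading an index `(k₁, …, k_r)` as a word in the forms `dt / t` and `2 dt / (1 - t ^ 2)`, the
value `T(k₁, …, k_r)` is the value at `t = 1` of an iterated integral `A w` starting at `0`, whose
Taylor coefficients are the parts of the series defining `T` with a fixed last entry `m_r`. On the
upper half `t = exp (iθ)`, `0 < θ < π`, of the unit circle the two forms become `i dθ` and `-dθ /
sin θ`. Hence `B w = (-i) ^ a * A w`, with `a` the number of letters `dt / t`, satisfies a *real*
system of differential equations; its real part `X w` and its imaginary part `Y w` satisfy it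
separately, and both have a parity under `θ ↦ π - θ`. As `θ → 0`, the number `T` shows up in `X w`
for even `a` and in `Y w` for odd `a`; when depth and weight have different parity, `a` is odd.

The point is that `Y w` has smaller depth. Indeed `Y` of the single letter `2 dt / (1 - t ^ 2)` is
the constant `π / 2`, and by induction on the word every `Y w` is a combination of the functions
`(θ - π / 2) ^ j * X u` with `u` of smaller depth and with coefficients built from `π` and
multiple `T`-values (`Y_inArcSpan`). A first letter `dt / t` is an integration in `θ`
(`Y_false_inArcSpan`); the integration constant is found from the parity about `π / 2` or from the
vanishing of the limit at `0`, if necessary after one more integration, which divides by `π`. A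
first letter `2 dt / (1 - t ^ 2)` is removed with the shuffle product by the logarithm `A [true]`
(`Y_true_inArcSpan`), so that no regularization at `t = 1` is needed. Keeping track of depths,
weights and the parity of the exponent of `π`, the limit `θ → 0` gives `T` of odd `a` as a
combination of products of values of total depth less than `r` with even powers of `π`
(`T_mem_piT_of_odd`), and `π ^ (2 l)` is a rational multiple of `T(2 l)`.

In depth two the induction is explicit: `Y` of the word of `(m + 1, n + 1)` is the bilinear
expression `depthTwoMain` up to a remainder `depthTwoRest`, a sequence of functions each of which
is the derivative of the next. Pairing the remainders with Bernoulli polynomials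
(`sum_bernoulliArc_mul_depthTwoRest`) expresses the limits of those of odd weight by the limits of
those of even weight, which are multiples of `π * T(p + μ)`; the Bernoulli numbers account for the
factors `T(q - μ) / (2 ^ (q - μ) - 1)`.
-/

namespace MTV

section

open Complex Set Filter Topology Metric

/-! ### Power series of iterated integrals -/

/-- Taylor coefficients at `0` of the iterated integral of a word. In a word `true` stands for the
form `2 dt / (1 - t ^ 2)` and `false` for `dt / t`; the head of the list is the outermost form. -/
noncomputable def coeff : List Bool → ℕ → ℝ
  | [], n => if n = 0 then 1 else 0
  | true :: w, n => 2 / n * ∑ m ∈ (Finset.range n).filter (fun m => (m + n) % 2 = 1), coeff w m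
  | false :: w, n => coeff w n / n

lemma coeff_zero {w : List Bool} (hw : w ≠ []) : coeff w 0 = 0 := by
  match w, hw with
  | true :: w, _ => simp [coeff]
  | false :: w, _ => simp [coeff]

lemma coeff_nonneg (w : List Bool) (n : ℕ) : 0 ≤ coeff w n := by
  induction w generalizing n with
  | nil => simp only [coeff]; split_ifs <;> norm_num
  | cons x w ih =>
    cases x
    · exact div_nonneg (ih n) n.cast_nonneg
    · exact mul_nonneg (by positivity) (Finset.sum_nonneg fun m _ => ih m)

lemma coeff_eq_zero_of_odd (w : List Bool) (n : ℕ) (h : (n + w.count true) % 2 = 1) :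
    coeff w n = 0 := by
  induction w generalizing n with
  | nil =>
    have : n ≠ 0 := by rintro rfl; simp at h
    simp [coeff, this]
  | cons x w ih =>
    cases x
    · simp only [coeff]; rw [ih n (by simpa using h)]; simp
    · simp only [coeff]
      rw [Finset.sum_eq_zero, mul_zero]
      intro m hm
      rw [Finset.mem_filter] at hm
      apply ih
      rw [List.count_cons_self] at h
      omega

lemma coeff_le (w : List Bool) : ∃ C : ℝ, ∀ n, coeff w n ≤ C := by
  induction w with
  | nil => exact ⟨1, fun n => by simp only [coeff]; split_ifs <;> norm_num⟩
  | cons x w ih =>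
    obtain ⟨C, hC⟩ := ih
    have hC0 : 0 ≤ C := (coeff_nonneg w 0).trans (hC 0)
    cases x
    · refine ⟨C, fun n => ?_⟩
      rcases Nat.eq_zero_or_pos n with rfl | hn
      · rw [coeff_zero (by simp)]; exact hC0
      · exact (div_le_self (coeff_nonneg w n) (by exact_mod_cast hn)).trans (hC n)
    · refine ⟨2 * C, fun n => ?_⟩
      rcases Nat.eq_zero_or_pos n with rfl | hn
      · rw [coeff_zero (by simp)]; positivity
      · simp only [coeff]
        have h1 : ∑ m ∈ (Finset.range n).filter (fun m => (m + n) % 2 = 1), coeff w m ≤ n * C := by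
          refine (Finset.sum_le_card_nsmul _ _ C fun m _ => hC m).trans ?_
          rw [nsmul_eq_mul]
          gcongr
          exact (Finset.card_filter_le _ _).trans (by simp)
        have hn' : (0 : ℝ) < n := by exact_mod_cast hn
        calc _ ≤ 2 / (n : ℝ) * (n * C) := by gcongr
          _ = 2 * C := by field_simp

lemma norm_coeff_le (w : List Bool) : ∃ C : ℝ, ∀ n, ‖(coeff w n : ℂ)‖ ≤ C := by
  obtain ⟨C, hC⟩ := coeff_le w
  exact ⟨C, fun n => by
    rw [Complex.norm_real, Real.norm_of_nonneg (coeff_nonneg w n)]; exact hC n⟩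

lemma summable_mul_pow {c : ℕ → ℂ} {C : ℝ} (hc : ∀ n, ‖c n‖ ≤ C) {t : ℂ} (ht : ‖t‖ < 1) :
    Summable fun n => c n * t ^ n := by
  refine Summable.of_norm_bounded (g := fun n => C * ‖t‖ ^ n)
    ((summable_geometric_of_lt_one (norm_nonneg _) ht).mul_left C) fun n => ?_
  rw [norm_mul, norm_pow]
  exact mul_le_mul_of_nonneg_right (hc n) (by positivity)

lemma hasDerivAt_tsum_mul_pow {c : ℕ → ℂ} {C : ℝ} (hc : ∀ n, ‖c n‖ ≤ C) {t : ℂ} (ht : ‖t‖ < 1) :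
    HasDerivAt (fun z => ∑' n, c n * z ^ n) (∑' n : ℕ, ((n : ℂ) + 1) * c (n + 1) * t ^ n) t := by
  obtain ⟨r, hr, hr1⟩ := exists_between ht
  have hr0 : 0 ≤ r := (norm_nonneg t).trans hr.le
  have hu : Summable fun n : ℕ => C * r ^ n := (summable_geometric_of_lt_one hr0 hr1).mul_left C
  have hf : ∀ n : ℕ, DifferentiableOn ℂ (fun z => c n * z ^ n) (ball 0 r) := fun n => by fun_prop
  have hb : ∀ (n : ℕ) (z : ℂ), z ∈ ball (0 : ℂ) r → ‖c n * z ^ n‖ ≤ C * r ^ n := by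
    intro n z hz
    rw [mem_ball_zero_iff] at hz
    rw [norm_mul, norm_pow]
    have h0 : 0 ≤ C := (norm_nonneg _).trans (hc 0)
    gcongr
    exact hc n
  have ht' : t ∈ ball (0 : ℂ) r := by rwa [mem_ball_zero_iff]
  have h1 := Complex.hasSum_deriv_of_summable_norm hu hf isOpen_ball hb ht'
  have h2 := (Complex.differentiableOn_tsum_of_summable_norm hu hf isOpen_ball hb).differentiableAt
    (isOpen_ball.mem_nhds ht')
  have h3 : deriv (fun z => ∑' n, c n * z ^ n) t = ∑' n : ℕ, ((n : ℂ) + 1) * c (n + 1) * t ^ n := by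
    rw [← h1.tsum_eq, h1.summable.tsum_eq_zero_add]
    have : ∀ n : ℕ, deriv (fun z : ℂ => c n * z ^ n) t = c n * (n * t ^ (n - 1)) := by
      intro n; rw [deriv_const_mul_field]; simp
    simp only [this]
    simp only [Nat.cast_zero, zero_mul, mul_zero, zero_add, Nat.cast_add, Nat.cast_one,
      Nat.add_sub_cancel]
    congr 1; ext n; ring
  rw [← h3]
  exact h2.hasDerivAt

/-- The power series with coefficients `coeff w`, meaningful for `‖t‖ < 1`. -/
noncomputable def series (w : List Bool) (t : ℂ) : ℂ := ∑' n, (coeff w n : ℂ) * t ^ n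

lemma series_nil (t : ℂ) : series [] t = 1 := by
  unfold series
  rw [tsum_eq_single 0]
  · simp [coeff]
  · intro n hn; simp [coeff, hn]

lemma series_zero {w : List Bool} (hw : w ≠ []) : series w 0 = 0 := by
  unfold series
  rw [tsum_eq_single 0]
  · simp [coeff_zero hw]
  · intro n hn; simp [hn]

lemma differentiableAt_series (w : List Bool) {t : ℂ} (ht : ‖t‖ < 1) :
    DifferentiableAt ℂ (series w) t := by
  obtain ⟨C, hC⟩ := norm_coeff_le w
  exact (hasDerivAt_tsum_mul_pow hC ht).differentiableAt

lemma hasDerivAt_series_false {w : List Bool} (hw : w ≠ []) {t : ℂ} (ht : ‖t‖ < 1) :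
    HasDerivAt (series (false :: w)) (dslope (series w) 0 t) t := by
  obtain ⟨C, hC⟩ := norm_coeff_le (false :: w)
  obtain ⟨C', hC'⟩ := norm_coeff_le w
  convert! hasDerivAt_tsum_mul_pow hC ht using 1
  have h1 : ∀ n : ℕ, ((n : ℂ) + 1) * (coeff (false :: w) (n + 1) : ℂ) = coeff w (n + 1) := by
    intro n
    have : (n : ℂ) + 1 ≠ 0 := by exact_mod_cast n.succ_ne_zero
    simp only [coeff]
    push_cast
    field_simp
  simp only [h1]
  rcases eq_or_ne t 0 with rfl | h0
  · rw [dslope_same]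
    have h2 := (hasDerivAt_tsum_mul_pow hC' (t := 0) (by simp)).deriv
    change deriv (series w) 0 = _ at h2
    rw [h2, tsum_eq_single 0 (by intro n hn; simp [hn]), tsum_eq_single 0 (by intro n hn; simp [hn])]
    simp
  · rw [dslope_of_ne _ h0, slope_def_field, series_zero hw]
    unfold series
    rw [(summable_mul_pow hC' ht).tsum_eq_zero_add, coeff_zero hw]
    simp only [pow_succ, ← mul_assoc]
    rw [tsum_mul_right]
    field_simp
    simp

/-- The coefficients `e n` of the derivative satisfy `e (n + 2) = e n + 2 * coeff w (n + 2)`, that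
is, `(1 - t ^ 2) * ∑ e n * t ^ n = 2 * series w t`. -/
lemma hasDerivAt_series_true (w : List Bool) {t : ℂ} (ht : ‖t‖ < 1) :
    HasDerivAt (series (true :: w)) (2 / (1 - t ^ 2) * series w t) t := by
  obtain ⟨C, hC⟩ := norm_coeff_le (true :: w)
  obtain ⟨C', hC'⟩ := norm_coeff_le w
  convert! hasDerivAt_tsum_mul_pow hC ht using 1
  set e : ℕ → ℂ := fun n => ((n : ℂ) + 1) * (coeff (true :: w) (n + 1) : ℂ) with he
  have he' : ∀ n, e n =
      2 * ∑ m ∈ (Finset.range (n + 1)).filter (fun m => (m + n) % 2 = 0), (coeff w m : ℂ) := by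
    intro n
    have : (n : ℂ) + 1 ≠ 0 := by exact_mod_cast n.succ_ne_zero
    have hf : (Finset.range (n + 1)).filter (fun m => (m + (n + 1)) % 2 = 1) =
        (Finset.range (n + 1)).filter (fun m => (m + n) % 2 = 0) := by
      apply Finset.filter_congr; intro m _; omega
    simp only [he, coeff, hf]
    push_cast
    field_simp
  have e0 : e 0 = 2 * coeff w 0 := by rw [he']; simp [Finset.range_one, Finset.filter_singleton]
  have e1 : e 1 = 2 * coeff w 1 := by
    rw [he']; simp [Finset.range_add_one, Finset.filter_insert, Finset.filter_singleton]
  have e2 : ∀ n, e (n + 2) = e n + 2 * coeff w (n + 2) := by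
    intro n
    rw [he', he', Finset.range_add_one, Finset.filter_insert, if_pos (by omega),
      Finset.sum_insert (by simp), Finset.range_add_one, Finset.filter_insert, if_neg (by omega)]
    have hf : (Finset.range (n + 1)).filter (fun m => (m + (n + 2)) % 2 = 0) =
        (Finset.range (n + 1)).filter (fun m => (m + n) % 2 = 0) := by
      apply Finset.filter_congr; intro m _; omega
    rw [hf]; ring
  have hs : Summable fun n => e n * t ^ n := by
    refine Summable.of_norm_bounded (g := fun n : ℕ => C * (((n : ℝ) + 1) * ‖t‖ ^ n)) ?_ ?_
    · apply Summable.mul_left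
      simp only [add_mul, one_mul]
      refine Summable.add ?_ (summable_geometric_of_lt_one (norm_nonneg _) ht)
      simpa using summable_pow_mul_geometric_of_norm_lt_one 1 (r := ‖t‖) (by simpa using ht)
    · intro n
      rw [norm_mul, norm_mul, norm_pow]
      have : ‖(n : ℂ) + 1‖ = (n : ℝ) + 1 := by
        have := Complex.norm_natCast (n + 1)
        push_cast at this; exact this
      rw [this]
      calc _ ≤ ((n : ℝ) + 1) * C * ‖t‖ ^ n := by gcongr; exact hC _
        _ = _ := by ring
  have hs2 : Summable fun n => (coeff w n : ℂ) * t ^ n := summable_mul_pow hC' ht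
  have hS := hs.sum_add_tsum_nat_add 2
  have hP := hs2.sum_add_tsum_nat_add 2
  have hs2' := (summable_nat_add_iff 2).2 hs2
  have key : ∑' n, e (n + 2) * t ^ (n + 2) =
      t ^ 2 * ∑' n, e n * t ^ n + 2 * ∑' n, (coeff w (n + 2) : ℂ) * t ^ (n + 2) := by
    rw [← tsum_mul_left, ← tsum_mul_left, ← Summable.tsum_add (hs.mul_left _) (hs2'.mul_left _)]
    congr 1; ext n; rw [e2]; ring
  have hne : 1 - t ^ 2 ≠ 0 := by
    intro h
    have : ‖t ^ 2‖ = 1 := by rw [← sub_eq_zero.1 h]; simp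
    rw [norm_pow] at this
    nlinarith [norm_nonneg t]
  simp only [Finset.sum_range_succ, Finset.sum_range_zero, zero_add, pow_zero, mul_one,
    pow_one] at hS hP
  change 2 / (1 - t ^ 2) * (∑' n, (coeff w n : ℂ) * t ^ n) = ∑' n, e n * t ^ n
  rw [div_mul_eq_mul_div, div_eq_iff hne]
  rw [key, e0, e1] at hS
  linear_combination hS - 2 * hP

/-! ### Iterated integrals on a disc through `±1` -/

/-- The open disc centred at `i` whose boundary passes through `1` and `-1`. It contains `0` and
the open upper half of the unit circle, but neither of the poles `±1`. -/
def disc : Set ℂ := ball I (√2)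

lemma isOpen_disc : IsOpen disc := isOpen_ball

lemma convex_disc : Convex ℝ disc := convex_ball _ _

lemma mem_disc_iff {t : ℂ} : t ∈ disc ↔ t.re ^ 2 + (t.im - 1) ^ 2 < 2 := by
  rw [disc, mem_ball, Complex.dist_eq, Real.lt_sqrt (norm_nonneg _), Complex.sq_norm,
    Complex.normSq_apply]
  simp [sq]

lemma zero_mem_disc : (0 : ℂ) ∈ disc := by rw [mem_disc_iff]; norm_num

lemma one_sub_sq_ne_zero {t : ℂ} (ht : t ∈ disc) : 1 - t ^ 2 ≠ 0 := by
  intro h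
  have h' : (t - 1) * (t + 1) = 0 := by linear_combination -h
  rw [mem_disc_iff] at ht
  rcases mul_eq_zero.1 h' with h | h
  · rw [sub_eq_zero.1 h] at ht; norm_num at ht
  · rw [eq_neg_of_add_eq_zero_left h] at ht; norm_num at ht

open Classical in
/-- The primitive on `disc` that vanishes at `0`; the zero function if there is none. -/
noncomputable def primitive (g : ℂ → ℂ) : ℂ → ℂ :=
  if h : IsExactOn g disc then (h.with_val_at 0 0).choose else 0

lemma primitive_zero (g : ℂ → ℂ) : primitive g 0 = 0 := by
  unfold primitive
  split_ifs with h
  · exact (h.with_val_at 0 0).choose_spec.1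
  · rfl

lemma hasDerivAt_primitive {g : ℂ → ℂ} (hg : DifferentiableOn ℂ g disc) {t : ℂ} (ht : t ∈ disc) :
    HasDerivAt (primitive g) (g t) t := by
  have h : IsExactOn g disc := DifferentiableOn.isExactOn_ball hg
  unfold primitive
  rw [dif_pos h]
  exact (h.with_val_at 0 0).choose_spec.2 t ht

/-- The iterated integral from `0` of a word, on `disc`. For the form `dt / t` the integrand `A w
t / t` is written `dslope (A w) 0`, which fills in the removable singularity at `0` when `A w 0 =
0`; for words that are not `Valid` the value is not the iterated integral. -/
noncomputable def A : List Bool → ℂ → ℂ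
  | [] => fun _ => 1
  | true :: w => primitive fun t => 2 / (1 - t ^ 2) * A w t
  | false :: w => primitive (dslope (A w) 0)

lemma A_nil (t : ℂ) : A [] t = 1 := rfl

lemma A_zero {w : List Bool} (hw : w ≠ []) : A w 0 = 0 := by
  match w, hw with
  | true :: w, _ => exact primitive_zero _
  | false :: w, _ => exact primitive_zero _

lemma differentiableOn_A (w : List Bool) : DifferentiableOn ℂ (A w) disc := by
  induction w with
  | nil => exact differentiableOn_const 1
  | cons x w ih =>
    cases x
    · have : DifferentiableOn ℂ (dslope (A w) 0) disc :=
        (Complex.differentiableOn_dslope (isOpen_disc.mem_nhds zero_mem_disc)).2 ih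
      exact fun t ht => (hasDerivAt_primitive this ht).differentiableAt.differentiableWithinAt
    · have : DifferentiableOn ℂ (fun t => 2 / (1 - t ^ 2) * A w t) disc := by
        refine DifferentiableOn.mul (DifferentiableOn.div (by fun_prop) (by fun_prop) ?_) ih
        exact fun t ht => one_sub_sq_ne_zero ht
      exact fun t ht => (hasDerivAt_primitive this ht).differentiableAt.differentiableWithinAt

lemma hasDerivAt_A_true (w : List Bool) {t : ℂ} (ht : t ∈ disc) :
    HasDerivAt (A (true :: w)) (2 / (1 - t ^ 2) * A w t) t := by
  refine hasDerivAt_primitive (g := fun t => 2 / (1 - t ^ 2) * A w t) ?_ ht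
  refine DifferentiableOn.mul (DifferentiableOn.div (by fun_prop) (by fun_prop) ?_)
    (differentiableOn_A w)
  exact fun t ht => one_sub_sq_ne_zero ht

lemma hasDerivAt_A_false_dslope (w : List Bool) {t : ℂ} (ht : t ∈ disc) :
    HasDerivAt (A (false :: w)) (dslope (A w) 0 t) t :=
  hasDerivAt_primitive ((Complex.differentiableOn_dslope (isOpen_disc.mem_nhds zero_mem_disc)).2
    (differentiableOn_A w)) ht

lemma hasDerivAt_A_false {w : List Bool} (hw : w ≠ []) {t : ℂ} (ht : t ∈ disc) (h0 : t ≠ 0) :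
    HasDerivAt (A (false :: w)) (A w t / t) t := by
  convert! hasDerivAt_A_false_dslope w ht using 1
  rw [dslope_of_ne _ h0, slope_def_field, A_zero hw, sub_zero, sub_zero]

/-- Words whose innermost form is `2 dt / (1 - t ^ 2)`, together with the empty word: those with
an iterated integral that converges at `0`. -/
def Valid (w : List Bool) : Prop := w.getLast? ≠ some false

lemma valid_nil : Valid [] := by simp [Valid]

lemma valid_cons {x : Bool} {w : List Bool} (h : w ≠ []) : Valid (x :: w) ↔ Valid w := by
  unfold Valid
  obtain ⟨y, w', rfl⟩ := List.exists_cons_of_ne_nil h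
  rw [List.getLast?_cons_cons]

lemma Valid.tail {x : Bool} {w : List Bool} (h : Valid (x :: w)) : Valid w := by
  by_cases hw : w = []
  · rw [hw]; exact valid_nil
  · exact (valid_cons hw).1 h

lemma Valid.ne_nil {w : List Bool} (h : Valid (false :: w)) : w ≠ [] := by
  rintro rfl; simp [Valid] at h

lemma valid_true_cons {w : List Bool} (h : Valid w) : Valid (true :: w) := by
  by_cases hw : w = []
  · rw [hw]; simp [Valid]
  · exact (valid_cons hw).2 h

lemma A_eq_series {w : List Bool} (hw : Valid w) {t : ℂ} (ht : t ∈ disc) (ht1 : ‖t‖ < 1) :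
    A w t = series w t := by
  have hopen : IsOpen (disc ∩ ball (0 : ℂ) 1) := isOpen_disc.inter isOpen_ball
  have hpre : IsPreconnected (disc ∩ ball (0 : ℂ) 1) :=
    (convex_disc.inter (convex_ball _ _)).isPreconnected
  have h0 : (0 : ℂ) ∈ disc ∩ ball (0 : ℂ) 1 := ⟨zero_mem_disc, by simp⟩
  suffices H : EqOn (A w) (series w) (disc ∩ ball (0 : ℂ) 1) from H ⟨ht, by simpa using ht1⟩
  induction w with
  | nil => intro z _; rw [series_nil]; rfl
  | cons x w ih =>
    specialize ih hw.tail
    refine hopen.eqOn_of_deriv_eq hpre ((differentiableOn_A _).mono inter_subset_left)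
      (fun z hz => (differentiableAt_series _ (by simpa using hz.2)).differentiableWithinAt)
      ?_ h0 (by rw [A_zero (by simp), series_zero (by simp)])
    intro z hz
    have hz1 : ‖z‖ < 1 := by simpa using hz.2
    cases x
    · rw [(hasDerivAt_A_false_dslope w hz.1).deriv, (hasDerivAt_series_false hw.ne_nil hz1).deriv]
      rcases eq_or_ne z 0 with rfl | hz0
      · rw [dslope_same, dslope_same]
        exact (ih.eventuallyEq_of_mem (hopen.mem_nhds h0)).deriv_eq
      · rw [dslope_of_ne _ hz0, dslope_of_ne _ hz0, slope_def_field, slope_def_field, ih hz, ih h0]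
    · rw [(hasDerivAt_A_true w hz.1).deriv, (hasDerivAt_series_true w hz1).deriv, ih hz]

end

section

open Set Filter Topology
open scoped ENNReal

/-! ### Multiple `T`-values as sums of power series coefficients -/

/-- The index encoded by a word, listed from its last entry `k_r` to its first entry `k₁`. -/
def revIndex : List Bool → List ℕ
  | [] => []
  | true :: w => 1 :: revIndex w
  | false :: w => (revIndex w).modifyHead (· + 1)

lemma length_revIndex (w : List Bool) : (revIndex w).length = w.count true := by
  induction w with
  | nil => rfl
  | cons x w ih => cases x <;> simp [revIndex, ih]

lemma one_le_of_mem_revIndex (w : List Bool) : ∀ a ∈ revIndex w, 1 ≤ a := by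
  induction w with
  | nil => simp [revIndex]
  | cons x w ih =>
    cases x
    · simp only [revIndex]
      cases h : revIndex w with
      | nil => simp
      | cons k ks =>
        rw [h] at ih
        simp only [List.modifyHead_cons, List.mem_cons, forall_eq_or_imp] at ih ⊢
        exact ⟨by omega, ih.2⟩
    · simpa [revIndex] using ih

lemma revIndex_ne_nil {w : List Bool} (hw : Valid w) (h : w ≠ []) : revIndex w ≠ [] := by
  induction w with
  | nil => exact absurd rfl h
  | cons x w ih =>
    cases x
    · have := ih hw.tail hw.ne_nil
      simpa [revIndex] using this
    · simp [revIndex]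

lemma sum_revIndex {w : List Bool} (hw : Valid w) : (revIndex w).sum = w.length := by
  induction w with
  | nil => rfl
  | cons x w ih =>
    have ih := ih hw.tail
    cases x
    · have h := revIndex_ne_nil hw.tail hw.ne_nil
      simp only [revIndex]
      obtain ⟨k, ks, hk⟩ := List.exists_cons_of_ne_nil h
      rw [hk] at ih ⊢
      simp only [List.modifyHead_cons, List.sum_cons, List.length_cons] at ih ⊢
      omega
    · simp [revIndex, ih, add_comm]

/-- Words of admissible indices: the outermost form is `dt / t`, so that the iterated integral
converges at `1`. -/
def IsAdm (w : List Bool) : Prop := Valid w ∧ w.head? = some false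

lemma IsAdm.valid {w : List Bool} (h : IsAdm w) : Valid w := h.1

lemma IsAdm.exists_eq {w : List Bool} (h : IsAdm w) : ∃ w', w = false :: w' ∧ Valid w' ∧ w' ≠ [] := by
  match w, h with
  | false :: w, h => exact ⟨w, rfl, h.1.tail, h.1.ne_nil⟩
  | true :: w, h => simp [IsAdm] at h
  | [], h => simp [IsAdm] at h

lemma admissible_index {w : List Bool} (h : IsAdm w) : Admissible (revIndex w).reverse := by
  refine ⟨fun a ha => one_le_of_mem_revIndex w a (by simpa using ha), ?_⟩
  obtain ⟨w', rfl, hv, hne⟩ := h.exists_eq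
  obtain ⟨k, ks, hk⟩ := List.exists_cons_of_ne_nil (revIndex_ne_nil hv hne)
  have := one_le_of_mem_revIndex w' k (by simp [hk])
  simp only [revIndex, hk, List.modifyHead_cons]
  exact ⟨by simp, by simp; omega⟩

lemma exists_word (ks : List ℕ) (h : ∀ a ∈ ks, 1 ≤ a) : ∃ w, Valid w ∧ revIndex w = ks := by
  induction ks with
  | nil => exact ⟨[], valid_nil, rfl⟩
  | cons k ks ih =>
    obtain ⟨w, hw, rfl⟩ := ih fun a ha => h a (by simp [ha])
    have hk : 1 ≤ k := h k (by simp)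
    clear ih h
    induction k, hk using Nat.le_induction with
    | base => exact ⟨true :: w, valid_true_cons hw, rfl⟩
    | succ k hk ih =>
      obtain ⟨v, hv, hvk⟩ := ih
      have hne : v ≠ [] := by rintro rfl; simp [revIndex] at hvk
      exact ⟨false :: v, (valid_cons hne).2 hv, by simp [revIndex, hvk]⟩

lemma exists_word_of_admissible {k : List ℕ} (hk : Admissible k) :
    ∃ w, IsAdm w ∧ (revIndex w).reverse = k := by
  obtain ⟨w, hw, hwk⟩ := exists_word k.reverse fun a ha => hk.1 a (by simpa using ha)
  refine ⟨w, ⟨hw, ?_⟩, by rw [hwk, List.reverse_reverse]⟩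
  obtain ⟨h, h2⟩ := hk.2
  match w, hw, hwk with
  | [], _, hwk => exact absurd (by simpa [revIndex] using hwk.symm) h
  | false :: w, _, _ => rfl
  | true :: w, _, hwk =>
    have h3 : k = (revIndex w).reverse ++ [1] := by
      rw [← List.reverse_reverse k, ← hwk]; simp [revIndex]
    subst h3
    simp at h2

/-- The part `m_r = n` of the series `T(k₁, …, k_r)`, for an index listed from `k_r` to `k₁`. -/
noncomputable def indexCoeff : List ℕ → ℕ → ℝ
  | [], n => if n = 0 then 1 else 0
  | k :: ks, n =>
    2 / (n : ℝ) ^ k * ∑ m ∈ (Finset.range n).filter (fun m => (m + n) % 2 = 1), indexCoeff ks m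

lemma coeff_eq_indexCoeff {w : List Bool} (hw : Valid w) (n : ℕ) :
    coeff w n = indexCoeff (revIndex w) n := by
  induction w generalizing n with
  | nil => rfl
  | cons x w ih =>
    have ih := ih hw.tail
    cases x
    · have h := revIndex_ne_nil hw.tail hw.ne_nil
      obtain ⟨k, ks, hk⟩ := List.exists_cons_of_ne_nil h
      simp only [revIndex, coeff, ih, hk, List.modifyHead_cons, indexCoeff, pow_succ]
      rcases Nat.eq_zero_or_pos n with rfl | hn
      · simp
      · field_simp
    · simp only [revIndex, coeff, indexCoeff, ih, pow_one]

lemma indexCoeff_nonneg (k : List ℕ) (n : ℕ) : 0 ≤ indexCoeff k n := by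
  induction k generalizing n with
  | nil => simp only [indexCoeff]; split_ifs <;> norm_num
  | cons k ks ih => exact mul_nonneg (by positivity) (Finset.sum_nonneg fun m _ => ih m)

/-- The summation sets of depth `r + 1` as pairs of a tuple of depth `r` and a last entry. -/
def summationEquiv (r : ℕ) : summationSet (r + 1) ≃
    {x : summationSet r × ℕ // (∀ i, x.1.1 i < x.2) ∧ 0 < x.2 ∧ x.2 ≡ r + 1 [MOD 2]} where
  toFun m := ⟨(⟨fun i => m.1 i.castSucc, fun i => m.2.1 _,
      fun i j h => m.2.2.1 (Fin.castSucc_lt_castSucc_iff.2 h), fun i => m.2.2.2 i.castSucc⟩,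
      m.1 (Fin.last r)), fun i => m.2.2.1 (Fin.castSucc_lt_last i), m.2.1 _, m.2.2.2 (Fin.last r)⟩
  invFun x := ⟨Fin.snoc (α := fun _ => ℕ) x.1.1.1 x.1.2, by
    obtain ⟨⟨⟨m, hm⟩, n⟩, h1, h2, h3⟩ := x
    dsimp only at h1 h2 h3 ⊢
    refine ⟨fun i => ?_, fun i j hij => ?_, fun i => ?_⟩
    · refine Fin.lastCases ?_ (fun i => ?_) i
      · simpa using h2
      · simpa using hm.1 i
    · revert hij
      refine Fin.lastCases ?_ (fun j => ?_) j
      · refine Fin.lastCases ?_ (fun i => ?_) i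
        · simp
        · intro _; simpa using h1 i
      · refine Fin.lastCases ?_ (fun i => ?_) i
        · intro h; exact absurd h (not_lt.2 (Fin.le_last _))
        · intro h; simpa using hm.2.1 (Fin.castSucc_lt_castSucc_iff.1 h)
    · refine Fin.lastCases ?_ (fun i => ?_) i
      · simpa using h3
      · simpa using hm.2.2 i⟩
  left_inv m := by
    ext i
    refine Fin.lastCases ?_ (fun i => ?_) i <;> simp
  right_inv x := by
    obtain ⟨⟨⟨m, hm⟩, n⟩, h⟩ := x
    simp

/-- The summand of a multiple `T`-value with its factor `2 ^ r`, with values in `ℝ≥0∞`, where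
series may be rearranged freely. -/
noncomputable def summand (k : ℕ → ℕ) (r : ℕ) (m : Fin r → ℕ) : ℝ≥0∞ :=
  ∏ i : Fin r, ENNReal.ofReal (2 / (m i : ℝ) ^ k i)

/-- The last entry of a tuple, `0` for the empty one. -/
def lastEntry : (r : ℕ) → (Fin r → ℕ) → ℕ
  | 0, _ => 0
  | r + 1, m => m (Fin.last r)

lemma forall_lt_iff_lastEntry {r : ℕ} (m : summationSet r) {n : ℕ} (hn : 0 < n) :
    (∀ i, m.1 i < n) ↔ lastEntry r m.1 < n := by
  cases r with
  | zero => simp [lastEntry, hn]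
  | succ r =>
    refine ⟨fun h => h _, fun h i => lt_of_le_of_lt ?_ h⟩
    exact m.2.2.1.monotone (Fin.le_last i)

lemma lastEntry_mod {r : ℕ} (m : summationSet r) : lastEntry r m.1 ≡ r [MOD 2] := by
  cases r with
  | zero => rfl
  | succ r => exact m.2.2.2 (Fin.last r)

lemma tsum_summand_lastEntry (ks : List ℕ) (n : ℕ) :
    ∑' m : summationSet ks.length,
      (if lastEntry _ m.1 = n then summand (fun i => ks.reverse.getD i 0) ks.length m.1 else 0)
      = ENNReal.ofReal (indexCoeff ks n) := by
  induction ks generalizing n with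
  | nil =>
    have : Unique (summationSet ([] : List ℕ).length) :=
      ⟨⟨⟨fun i => i.elim0, fun i => i.elim0, fun i => i.elim0, fun i => i.elim0⟩⟩,
        fun m => Subtype.ext (funext fun i => i.elim0)⟩
    rw [tsum_eq_single default (fun b hb => absurd (Subsingleton.elim _ _) hb)]
    simp only [List.length_nil, lastEntry, summand, indexCoeff, Finset.univ_eq_empty,
      Finset.prod_empty, eq_comm (a := 0)]
    split_ifs <;> simp
  | cons k ks ih =>
    set r := ks.length with hr
    have hk : (k :: ks).length = r + 1 := by simp [hr]
    rw [hk]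
    have hterm : ∀ x : {x : summationSet r × ℕ //
        (∀ i, x.1.1 i < x.2) ∧ 0 < x.2 ∧ x.2 ≡ r + 1 [MOD 2]},
        (if lastEntry (r + 1) ((summationEquiv r).symm x).1 = n then
          summand (fun i => (k :: ks).reverse.getD i 0) (r + 1) ((summationEquiv r).symm x).1 else 0) =
        if x.1.2 = n then summand (fun i => ks.reverse.getD i 0) r x.1.1.1 *
          ENNReal.ofReal (2 / (n : ℝ) ^ k) else 0 := by
      rintro ⟨⟨⟨m, hm⟩, n'⟩, h⟩
      simp only [summationEquiv, Equiv.coe_fn_symm_mk, lastEntry, Fin.snoc_last]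
      refine if_ctx_congr Iff.rfl (fun hn => ?_) fun _ => rfl
      rw [summand, Fin.prod_univ_castSucc]
      simp only [Fin.snoc_castSucc, Fin.snoc_last, List.reverse_cons, Fin.val_castSucc, Fin.val_last]
      rw [hn, List.getD_append_right _ _ _ _ (by simp [hr])]
      have h0 : r - ks.reverse.length = 0 := by simp [hr]
      rw [h0]
      simp only [List.getD_cons_zero]
      congr 1
      refine Finset.prod_congr rfl fun i _ => ?_
      rw [List.getD_append _ _ _ _ (by simp only [List.length_reverse]; exact i.2)]
    rw [← (summationEquiv r).symm.tsum_eq, tsum_congr hterm]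
    refine (tsum_subtype
      {x : summationSet r × ℕ | (∀ i, x.1.1 i < x.2) ∧ 0 < x.2 ∧ x.2 ≡ r + 1 [MOD 2]}
      (fun x => if x.2 = n then summand (fun i => ks.reverse.getD i 0) r x.1.1 *
          ENNReal.ofReal (2 / (n : ℝ) ^ k) else 0)).trans ?_
    rw [ENNReal.summable.tsum_prod' (fun _ => ENNReal.summable)]
    have hin : ∀ m : summationSet r, ∑' n' : ℕ, Set.indicator
        {x : summationSet r × ℕ | (∀ i, x.1.1 i < x.2) ∧ 0 < x.2 ∧ x.2 ≡ r + 1 [MOD 2]}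
        (fun x => if x.2 = n then summand (fun i => ks.reverse.getD i 0) r x.1.1 *
          ENNReal.ofReal (2 / (n : ℝ) ^ k) else 0) (m, n') =
        (∑ l ∈ (Finset.range n).filter (fun l => (l + n) % 2 = 1),
          if lastEntry r m.1 = l then summand (fun i => ks.reverse.getD i 0) r m.1 else 0) *
          ENNReal.ofReal (2 / (n : ℝ) ^ k) := by
      intro m
      rw [tsum_eq_single n]
      · rw [Finset.sum_ite_eq]
        simp only [Set.indicator_apply, Set.mem_ofPred_eq, if_true, Finset.mem_filter,
          Finset.mem_range]
        have hiff : ((∀ i, m.1 i < n) ∧ 0 < n ∧ n ≡ r + 1 [MOD 2]) ↔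
            (lastEntry r m.1 < n ∧ (lastEntry r m.1 + n) % 2 = 1) := by
          have hl := lastEntry_mod m
          unfold Nat.ModEq at hl ⊢
          constructor
          · rintro ⟨h1, h2, h3⟩
            exact ⟨(forall_lt_iff_lastEntry m h2).1 h1, by omega⟩
          · rintro ⟨h1, h2⟩
            have h0 : 0 < n := by omega
            exact ⟨(forall_lt_iff_lastEntry m h0).2 h1, h0, by omega⟩
        rw [if_congr hiff rfl rfl]
        split_ifs <;> simp
      · intro n' hn'
        simp [Set.indicator_apply, hn']
    rw [tsum_congr hin, ENNReal.tsum_mul_right, Summable.tsum_finsetSum (fun _ _ => ENNReal.summable)]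
    simp only [ih, indexCoeff]
    rw [← ENNReal.ofReal_sum_of_nonneg (fun _ _ => indexCoeff_nonneg _ _),
      ← ENNReal.ofReal_mul (Finset.sum_nonneg fun _ _ => indexCoeff_nonneg _ _), mul_comm]

lemma T_reverse_eq_tsum (ks : List ℕ) : T ks.reverse = ∑' n, indexCoeff ks n := by
  have h1 : ∀ r, ks.reverse.length = r → T ks.reverse =
      ∑' m : summationSet r, (summand (fun i => ks.reverse.getD i 0) r m.1).toReal := by
    rintro r rfl
    rw [T, ← tsum_mul_left]
    refine tsum_congr fun m => ?_
    rw [summand, ENNReal.toReal_prod, ← Fin.prod_const, ← Finset.prod_mul_distrib]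
    refine Finset.prod_congr rfl fun i _ => ?_
    rw [ENNReal.toReal_ofReal (by positivity), List.getD_eq_getElem _ _ i.2]
    simp [div_eq_mul_inv]
  have h3 : ∀ m : summationSet ks.length,
      summand (fun i => ks.reverse.getD i 0) ks.length m.1 ≠ ∞ :=
    fun m => ENNReal.prod_ne_top fun i _ => ENNReal.ofReal_ne_top
  rw [h1 ks.length (by simp), ← ENNReal.tsum_toReal_eq h3]
  have h2 : ∀ n, indexCoeff ks n = (ENNReal.ofReal (indexCoeff ks n)).toReal := fun n =>
    (ENNReal.toReal_ofReal (indexCoeff_nonneg _ _)).symm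
  rw [tsum_congr h2, ← ENNReal.tsum_toReal_eq (fun n => ENNReal.ofReal_ne_top)]
  congr 1
  simp only [← tsum_summand_lastEntry]
  rw [ENNReal.tsum_comm]
  refine tsum_congr fun m => ?_
  rw [tsum_eq_single (lastEntry _ m.1) (fun n hn => if_neg hn.symm), if_pos rfl]

lemma T_index_eq_tsum {w : List Bool} (hw : Valid w) :
    T (revIndex w).reverse = ∑' n, coeff w n := by
  rw [T_reverse_eq_tsum]
  exact tsum_congr fun n => (coeff_eq_indexCoeff hw n).symm

/-! ### Absolute convergence for admissible words -/

/-- The partial sums of the coefficients grow at most like a power of the logarithm, since `∑ 1 /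
m ≤ 1 + log n`. -/
lemma sum_coeff_le (w : List Bool) (n : ℕ) :
    ∑ m ∈ Finset.range n, coeff w m ≤ (2 + 2 * Real.log (n + 1)) ^ w.length := by
  have hlog : ∀ n : ℕ, 0 ≤ Real.log ((n : ℝ) + 1) := fun n =>
    Real.log_nonneg (by linarith [n.cast_nonneg (α := ℝ)])
  have hH : ∀ n : ℕ, ∑ m ∈ Finset.range n, (1 : ℝ) / m ≤ 1 + Real.log (n + 1) := by
    intro n
    rcases Nat.eq_zero_or_pos n with rfl | hn
    · simp
    · obtain ⟨n, rfl⟩ := Nat.exists_eq_succ_of_ne_zero hn.ne'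
      rw [Finset.sum_range_succ']
      have h := harmonic_le_one_add_log n
      rw [harmonic] at h
      push_cast at h
      simp only [Nat.cast_add, Nat.cast_one, one_div, Nat.cast_zero, inv_zero, add_zero]
      refine h.trans (add_le_add_right ?_ 1)
      rcases Nat.eq_zero_or_pos n with rfl | hn'
      · simpa using Real.log_nonneg (by norm_num)
      · apply Real.log_le_log (by exact_mod_cast hn')
        push_cast; linarith
  induction w with
  | nil =>
    simp only [coeff, List.length_nil, pow_zero, Finset.sum_ite_eq', Finset.mem_range]
    split_ifs <;> norm_num
  | cons x w ih =>
    set S := ∑ m ∈ Finset.range n, coeff w m with hS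
    have hS0 : 0 ≤ S := Finset.sum_nonneg fun _ _ => coeff_nonneg _ _
    have hb : ∀ m ∈ Finset.range n, coeff (x :: w) m ≤ 2 * S * (1 / m) := by
      intro m hm
      rw [Finset.mem_range] at hm
      cases x
      · have : coeff w m ≤ S := Finset.single_le_sum (f := coeff w) (fun _ _ => coeff_nonneg _ _)
          (Finset.mem_range.2 hm)
        simp only [coeff]
        rw [div_eq_mul_one_div]
        gcongr
        linarith
      · simp only [coeff]
        have : ∑ l ∈ (Finset.range m).filter (fun l => (l + m) % 2 = 1), coeff w l ≤ S :=
          Finset.sum_le_sum_of_subset_of_nonneg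
            ((Finset.filter_subset _ _).trans (Finset.range_mono hm.le))
            (fun _ _ _ => coeff_nonneg _ _)
        calc _ ≤ 2 / (m : ℝ) * S := by gcongr
          _ = _ := by ring
    calc _ ≤ ∑ m ∈ Finset.range n, 2 * S * (1 / m) := Finset.sum_le_sum hb
      _ = 2 * S * ∑ m ∈ Finset.range n, (1 : ℝ) / m := (Finset.mul_sum _ _ _).symm
      _ ≤ 2 * (2 + 2 * Real.log (n + 1)) ^ w.length * (1 + Real.log (n + 1)) := by
        have := hlog n
        exact mul_le_mul (by linarith) (hH n) (Finset.sum_nonneg fun _ _ => by positivity)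
          (by positivity)
      _ = _ := by rw [List.length_cons, pow_succ]; ring

lemma coeff_le_div (w : List Bool) (hw : Valid w) (h : w ≠ []) (n : ℕ) :
    coeff w n ≤ 2 * (2 + 2 * Real.log (n + 1)) ^ w.length / n := by
  have hlog : 0 ≤ Real.log ((n : ℝ) + 1) :=
    Real.log_nonneg (by linarith [n.cast_nonneg (α := ℝ)])
  have h1 : 1 ≤ 2 + 2 * Real.log ((n : ℝ) + 1) := by linarith
  induction w with
  | nil => exact absurd rfl h
  | cons x w ih =>
    cases x
    · have ih := ih hw.tail hw.ne_nil
      rcases Nat.eq_zero_or_pos n with rfl | hn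
      · simp [coeff]
      · simp only [coeff]
        refine (div_le_self (coeff_nonneg _ _) (by exact_mod_cast hn)).trans (ih.trans ?_)
        gcongr 2 * ?_ / _
        exact pow_le_pow_right₀ h1 (by simp)
    · simp only [coeff]
      have h2 : ∑ m ∈ (Finset.range n).filter (fun m => (m + n) % 2 = 1), coeff w m ≤
          (2 + 2 * Real.log ((n : ℝ) + 1)) ^ w.length :=
        (Finset.sum_le_sum_of_subset_of_nonneg (Finset.filter_subset _ _)
          (fun _ _ _ => coeff_nonneg _ _)).trans (sum_coeff_le w n)
      calc _ ≤ 2 / (n : ℝ) * (2 + 2 * Real.log ((n : ℝ) + 1)) ^ w.length := by gcongr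
        _ = 2 * (2 + 2 * Real.log ((n : ℝ) + 1)) ^ w.length / n := by ring
        _ ≤ _ := by
          gcongr 2 * ?_ / _
          exact pow_le_pow_right₀ h1 (by simp)

lemma summable_coeff {w : List Bool} (h : IsAdm w) : Summable (coeff w) := by
  obtain ⟨w, rfl, hv, hne⟩ := h.exists_eq
  have hlog : (fun x : ℝ => 2 + 2 * Real.log (x + 1)) =O[atTop] Real.log := by
    refine Asymptotics.IsBigO.of_bound 6 ?_
    filter_upwards [eventually_ge_atTop 3] with x hx
    have h1 : 1 ≤ Real.log x := by
      rw [Real.le_log_iff_exp_le (by linarith)]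
      exact Real.exp_one_lt_d9.le.trans (by linarith)
    have h2 : Real.log (x + 1) ≤ Real.log 2 + Real.log x := by
      rw [← Real.log_mul (by norm_num) (by linarith)]
      exact Real.log_le_log (by linarith) (by linarith)
    have h3 : 0 ≤ Real.log (x + 1) := Real.log_nonneg (by linarith)
    rw [Real.norm_of_nonneg (by linarith), Real.norm_of_nonneg (by linarith)]
    linarith [Real.log_two_lt_d9]
  have h1 : (fun x : ℝ => 2 * (2 + 2 * Real.log (x + 1)) ^ w.length) =O[atTop]
      fun x : ℝ => x ^ (1 / 2 : ℝ) := by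
    refine ((hlog.pow w.length).trans ?_).const_mul_left 2
    refine Asymptotics.IsBigO.congr_left
      (isLittleO_log_rpow_rpow_atTop (w.length : ℝ) (by norm_num : (0 : ℝ) < 1 / 2)).isBigO ?_
    exact fun x => Real.rpow_natCast _ _
  have h2 := h1.comp_tendsto tendsto_natCast_atTop_atTop
  refine summable_of_isBigO_nat (g := fun n : ℕ => 1 / (n : ℝ) ^ (3 / 2 : ℝ))
    (Real.summable_one_div_nat_rpow.2 (by norm_num)) ?_
  refine Asymptotics.IsBigO.trans (g := fun n : ℕ =>
    (2 * (2 + 2 * Real.log ((n : ℝ) + 1)) ^ w.length) * (1 / (n : ℝ) ^ 2)) ?_ ?_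
  · refine Asymptotics.IsBigO.of_bound 1 (Eventually.of_forall fun n => ?_)
    rw [Real.norm_of_nonneg (coeff_nonneg _ _), one_mul]
    refine le_trans ?_ (le_abs_self _)
    simp only [coeff]
    calc _ ≤ 2 * (2 + 2 * Real.log ((n : ℝ) + 1)) ^ w.length / n / n := by
          gcongr; exact coeff_le_div w hv hne n
      _ = _ := by rw [div_div, ← sq, div_eq_mul_one_div]
  · refine (h2.mul (Asymptotics.isBigO_refl (fun n : ℕ => 1 / (n : ℝ) ^ 2) atTop)).congr'
      EventuallyEq.rfl ?_
    filter_upwards [eventually_gt_atTop 0] with n hn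
    have hn' : (0 : ℝ) < n := by exact_mod_cast hn
    simp only [Function.comp_apply, one_div]
    rw [← Real.rpow_natCast, ← Real.rpow_neg hn'.le, ← Real.rpow_neg hn'.le, ← Real.rpow_add hn']
    norm_num

end

section

open Complex Set Filter Topology Metric

/-! ### The shuffle product with the logarithm -/

/-- All ways, with multiplicity, of inserting the letter `true` into a word: the shuffle product
of `[true]` and the word. -/
def insertions : List Bool → List (List Bool)
  | [] => [[true]]
  | x :: w => (true :: x :: w) :: (insertions w).map (x :: ·)

lemma mem_insertions {w v : List Bool} (hv : v ∈ insertions w) :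
    v.length = w.length + 1 ∧ v.count true = w.count true + 1 ∧ v.count false = w.count false := by
  induction w generalizing v with
  | nil => simp [insertions] at hv; simp [hv]
  | cons x w ih =>
    simp only [insertions, List.mem_cons, List.mem_map] at hv
    rcases hv with rfl | ⟨u, hu, rfl⟩
    · simp
    · obtain ⟨h1, h2, h3⟩ := ih hu
      cases x <;> simp [h1, h2, h3]

lemma valid_of_mem_insertions {w v : List Bool} (hw : Valid w) (hv : v ∈ insertions w) :
    Valid v := by
  induction w generalizing v with
  | nil => simp [insertions] at hv; simp [hv, Valid]
  | cons x w ih =>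
    simp only [insertions, List.mem_cons, List.mem_map] at hv
    rcases hv with rfl | ⟨u, hu, rfl⟩
    · exact valid_true_cons hw
    · refine (valid_cons ?_).2 (ih hw.tail hu)
      have := (mem_insertions hu).1
      rintro rfl; simp at this

lemma ne_nil_of_mem_insertions {w v : List Bool} (hv : v ∈ insertions w) : v ≠ [] := by
  have := (mem_insertions hv).1
  rintro rfl; simp at this

lemma hasDerivAt_list_sum {f f' : List Bool → ℂ → ℂ} {t : ℂ} (l : List (List Bool))
    (h : ∀ v ∈ l, HasDerivAt (f v) (f' v t) t) :
    HasDerivAt (fun z => (l.map (f · z)).sum) ((l.map (f' · t)).sum) t := by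
  induction l with
  | nil => simpa using hasDerivAt_const t (0 : ℂ)
  | cons v l ih =>
    simp only [List.map_cons, List.sum_cons]
    exact (h v (by simp)).add (ih fun u hu => h u (by simp [hu]))

lemma sum_insertions_zero (w : List Bool) : ((insertions w).map (A · 0)).sum = 0 := by
  refine List.sum_eq_zero fun x hx => ?_
  obtain ⟨v, hv, rfl⟩ := List.mem_map.1 hx
  exact A_zero (ne_nil_of_mem_insertions hv)

/-- The shuffle product with the single letter `true`: both sides vanish at `0` and have the same
derivative. -/
lemma A_true_mul {w : List Bool} (hw : Valid w) {t : ℂ} (ht : t ∈ disc) :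
    A [true] t * A w t = ((insertions w).map (A · t)).sum := by
  induction w generalizing t with
  | nil => simp [insertions, A_nil]
  | cons x w ih =>
    have ih := fun {t} => @ih hw.tail t
    have hsum : ∀ {t : ℂ}, t ∈ disc →
        HasDerivAt (fun z => ((insertions (x :: w)).map (A · z)).sum)
          (deriv (A [true]) t * A (x :: w) t + A [true] t * deriv (A (x :: w)) t) t := by
      intro t ht
      have h1 : HasDerivAt (fun z => ((insertions w).map (fun v => A (x :: v) z)).sum)
          (A [true] t * deriv (A (x :: w)) t) t := by
        cases x
        · rw [(hasDerivAt_A_false_dslope w ht).deriv]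
          convert! hasDerivAt_list_sum (f := fun v => A (false :: v))
            (f' := fun v => dslope (A v) 0) (insertions w)
            (fun v hv => hasDerivAt_A_false_dslope v ht) using 1
          rcases eq_or_ne t 0 with rfl | h0
          · rw [A_zero (by simp), zero_mul]
            have h2 := hasDerivAt_list_sum (f := A) (f' := fun v => deriv (A v)) (insertions w)
              (fun v hv => ((differentiableOn_A v).differentiableAt
                (isOpen_disc.mem_nhds zero_mem_disc)).hasDerivAt)
            have h3 : (fun z => ((insertions w).map (A · z)).sum) =ᶠ[𝓝 0]
                fun z => A [true] z * A w z := by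
              filter_upwards [isOpen_disc.mem_nhds zero_mem_disc] with z hz
              exact (ih hz).symm
            have h4 := (h2.congr_of_eventuallyEq h3.symm).deriv
            have h5 := ((hasDerivAt_A_true [] zero_mem_disc).mul
              ((differentiableOn_A w).differentiableAt
                (isOpen_disc.mem_nhds zero_mem_disc)).hasDerivAt).deriv
            simp only [dslope_same]
            rw [← h4]
            refine Eq.trans ?_ h5.symm
            rw [A_zero hw.ne_nil, A_zero (w := [true]) (by simp)]
            simp
          · simp only [dslope_of_ne _ h0, slope_def_field]
            rw [A_zero hw.ne_nil, sub_zero, sub_zero, ← mul_div_assoc, ih ht]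
            have : ∀ v ∈ insertions w, (A v t - A v 0) / t = A v t / t := fun v hv => by
              rw [A_zero (ne_nil_of_mem_insertions hv), sub_zero]
            rw [List.map_congr_left this]
            simp only [div_eq_mul_inv]
            exact (List.sum_map_mul_right ..).symm
        · rw [(hasDerivAt_A_true w ht).deriv]
          convert! hasDerivAt_list_sum (f := fun v => A (true :: v))
            (f' := fun v t => 2 / (1 - t ^ 2) * A v t) (insertions w)
            (fun v hv => hasDerivAt_A_true v ht) using 1
          rw [List.sum_map_mul_left, ← ih ht]
          ring
      have h2 := (hasDerivAt_A_true (x :: w) ht).fun_add h1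
      have h3 : deriv (A [true]) t = 2 / (1 - t ^ 2) := by
        rw [(hasDerivAt_A_true [] ht).deriv, A_nil, mul_one]
      rw [h3]
      simpa only [insertions, List.map_cons, List.sum_cons, List.map_map, Function.comp_def] using h2
    have hd : ∀ {t : ℂ} (v : List Bool), t ∈ disc → DifferentiableAt ℂ (A v) t := fun v ht =>
      (differentiableOn_A v).differentiableAt (isOpen_disc.mem_nhds ht)
    refine isOpen_disc.eqOn_of_deriv_eq (f := fun t => A [true] t * A (x :: w) t)
      (g := fun z => ((insertions (x :: w)).map (A · z)).sum) convex_disc.isPreconnected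
      (fun t ht => ((hd _ ht).mul (hd _ ht)).differentiableWithinAt)
      (fun t ht => (hsum ht).differentiableAt.differentiableWithinAt)
      (fun t ht => ?_) zero_mem_disc ?_ ht
    · rw [(hsum ht).deriv, deriv_fun_mul (hd _ ht) (hd _ ht)]
    · simp only [sum_insertions_zero]
      rw [A_zero (by simp), zero_mul]

/-! ### The logarithm on the disc -/

/-- The real part of `(1 + t) / (1 - t)`, whose logarithm is `A [true]`. -/
lemma re_cayley (t : ℂ) :
    ((1 + t) / (1 - t)).re = (1 - (t.re ^ 2 + t.im ^ 2)) / normSq (1 - t) := by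
  rw [Complex.div_re, ← add_div]
  congr 1
  simp; ring

lemma im_cayley (t : ℂ) : ((1 + t) / (1 - t)).im = 2 * t.im / normSq (1 - t) := by
  rw [Complex.div_im, ← sub_div]
  congr 1
  simp; ring

lemma normSq_one_sub_pos {t : ℂ} (ht : t ∈ disc) : 0 < normSq (1 - t) := by
  rw [Complex.normSq_pos]
  intro h
  apply one_sub_sq_ne_zero ht
  linear_combination (1 + t) * h

lemma cayley_mem_slitPlane {t : ℂ} (ht : t ∈ disc) : (1 + t) / (1 - t) ∈ slitPlane := by
  have h0 := normSq_one_sub_pos ht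
  rw [Complex.mem_slitPlane_iff, re_cayley, im_cayley]
  by_cases h : t.im = 0
  · left
    rw [mem_disc_iff, h] at ht
    apply div_pos _ h0
    rw [h]; nlinarith
  · right
    exact div_ne_zero (by simpa using h) h0.ne'

lemma A_singleton_true {t : ℂ} (ht : t ∈ disc) : A [true] t = Complex.log ((1 + t) / (1 - t)) := by
  have hd : ∀ {t : ℂ}, t ∈ disc →
      HasDerivAt (fun t => Complex.log ((1 + t) / (1 - t))) (2 / (1 - t ^ 2)) t := by
    intro t ht
    have h0 : 1 - t ≠ 0 := Complex.normSq_pos.1 (normSq_one_sub_pos ht)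
    have h1 : 1 + t ≠ 0 := by
      intro h
      apply one_sub_sq_ne_zero ht
      linear_combination (1 - t) * h
    convert! ((((hasDerivAt_id t).const_add 1).div ((hasDerivAt_id t).const_sub 1) h0).clog
      (cayley_mem_slitPlane ht)) using 1
    have h2 : 1 - t ^ 2 ≠ 0 := one_sub_sq_ne_zero ht
    have h3 : (1 - t ^ 2) = (1 - t) * (1 + t) := by ring
    simp only [id, Pi.div_apply, h3]
    field_simp
    ring
  refine isOpen_disc.eqOn_of_deriv_eq convex_disc.isPreconnected (differentiableOn_A _)
    (fun t ht => (hd ht).differentiableAt.differentiableWithinAt)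
      (fun t ht => ?_) zero_mem_disc ?_ ht
  · rw [(hasDerivAt_A_true [] ht).deriv, (hd ht).deriv, A_nil, mul_one]
  · rw [A_zero (by simp)]; simp

/-! ### Restriction to the upper half of the unit circle -/

/-- The parametrization of the unit circle by the angle. -/
noncomputable def arc (θ : ℝ) : ℂ := exp (θ * I)

lemma arc_re (θ : ℝ) : (arc θ).re = Real.cos θ := exp_ofReal_mul_I_re θ

lemma arc_im (θ : ℝ) : (arc θ).im = Real.sin θ := exp_ofReal_mul_I_im θ

lemma norm_arc (θ : ℝ) : ‖arc θ‖ = 1 := norm_exp_ofReal_mul_I θ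

lemma arc_ne_zero (θ : ℝ) : arc θ ≠ 0 := exp_ne_zero _

lemma arc_pi_sub (θ : ℝ) : arc (Real.pi - θ) = -(starRingEnd ℂ) (arc θ) := by
  apply Complex.ext
  · simp [arc_re]
  · simp [arc_im]

lemma arc_mem_disc {θ : ℝ} (hθ : θ ∈ Ioo 0 Real.pi) : arc θ ∈ disc := by
  rw [mem_disc_iff, arc_re, arc_im]
  nlinarith [Real.sin_pos_of_mem_Ioo hθ, Real.sin_sq_add_cos_sq θ]

lemma hasDerivAt_arc (θ : ℝ) : HasDerivAt arc (I * arc θ) θ := by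
  have h : HasDerivAt (fun x : ℝ => (x : ℂ) * I) I θ := by
    simpa using (hasDerivAt_id (θ : ℂ)).comp_ofReal.mul_const I
  convert! h.cexp using 1
  rw [arc, mul_comm]

lemma tendsto_radial (w : List Bool) {θ : ℝ} (hθ : θ ∈ Ioo 0 Real.pi) :
    Tendsto (fun ρ : ℝ => A w (ρ * arc θ)) (𝓝[<] 1) (𝓝 (A w (arc θ))) := by
  have h1 : ContinuousAt (A w) (arc θ) :=
    ((differentiableOn_A w).differentiableAt (isOpen_disc.mem_nhds (arc_mem_disc hθ))).continuousAt
  refine h1.tendsto.comp (tendsto_nhdsWithin_of_tendsto_nhds ?_)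
  have : ContinuousAt (fun ρ : ℝ => (ρ : ℂ) * arc θ) 1 := by fun_prop
  simpa [ContinuousAt] using this

lemma eventually_radial {θ : ℝ} (hθ : θ ∈ Ioo 0 Real.pi) :
    ∀ᶠ ρ : ℝ in 𝓝[<] 1, 0 < ρ ∧ ρ < 1 ∧ (ρ : ℂ) * arc θ ∈ disc ∧ ‖(ρ : ℂ) * arc θ‖ < 1 := by
  filter_upwards [Ioo_mem_nhdsLT (show (0 : ℝ) < 1 by norm_num)] with ρ hρ
  refine ⟨hρ.1, hρ.2, ?_, ?_⟩
  · have := convex_disc.smul_mem_of_zero_mem zero_mem_disc (arc_mem_disc hθ) ⟨hρ.1.le, hρ.2.le⟩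
    simpa using this
  · rw [norm_mul, norm_arc, mul_one, norm_real, Real.norm_of_nonneg hρ.1.le]
    exact hρ.2

/-- The coefficients are real, and those of the wrong parity vanish. -/
lemma series_neg_conj (w : List Bool) (t : ℂ) :
    series w (-(starRingEnd ℂ) t) = (-1) ^ w.count true * (starRingEnd ℂ) (series w t) := by
  unfold series
  rw [Complex.conj_tsum, ← tsum_mul_left]
  refine tsum_congr fun n => ?_
  by_cases h : (n + w.count true) % 2 = 1
  · simp [coeff_eq_zero_of_odd w n h]
  · have h2 : (-1 : ℂ) ^ n = (-1) ^ w.count true := by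
      rw [neg_one_pow_eq_pow_mod_two, neg_one_pow_eq_pow_mod_two (w.count true)]
      congr 1
      omega
    rw [neg_pow, h2]
    simp
    ring

lemma A_arc_pi_sub {w : List Bool} (hw : Valid w) {θ : ℝ} (hθ : θ ∈ Ioo 0 Real.pi) :
    A w (arc (Real.pi - θ)) = (-1) ^ w.count true * (starRingEnd ℂ) (A w (arc θ)) := by
  have hθ' : Real.pi - θ ∈ Ioo 0 Real.pi := ⟨by linarith [hθ.2], by linarith [hθ.1]⟩
  have h1 := tendsto_radial w hθ'
  have h2 : Tendsto (fun ρ : ℝ => (-1) ^ w.count true * (starRingEnd ℂ) (A w (ρ * arc θ)))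
      (𝓝[<] 1) (𝓝 ((-1) ^ w.count true * (starRingEnd ℂ) (A w (arc θ)))) :=
    ((Complex.continuous_conj.tendsto _).comp (tendsto_radial w hθ)).const_mul _
  refine tendsto_nhds_unique h1 (h2.congr' ?_)
  filter_upwards [eventually_radial hθ, eventually_radial hθ'] with ρ h3 h4
  rw [A_eq_series hw h3.2.2.1 h3.2.2.2, A_eq_series hw h4.2.2.1 h4.2.2.2, ← series_neg_conj,
    arc_pi_sub]
  simp

/-- Radial limits: for an admissible word the power series converges absolutely on the unit
circle. -/
lemma A_arc_eq_tsum {w : List Bool} (hw : IsAdm w) {θ : ℝ} (hθ : θ ∈ Ioo 0 Real.pi) :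
    A w (arc θ) = ∑' n, (coeff w n : ℂ) * arc θ ^ n := by
  have h1 := tendsto_radial w hθ
  have hsum : Summable fun n => ‖(coeff w n : ℂ)‖ := by
    simpa using (summable_coeff hw).norm
  have h2 : Tendsto (fun ρ : ℝ => ∑' n, (coeff w n : ℂ) * (ρ * arc θ) ^ n) (𝓝[<] 1)
      (𝓝 (∑' n, (coeff w n : ℂ) * arc θ ^ n)) := by
    refine tendsto_tsum_of_dominated_convergence hsum (fun n => ?_) ?_
    · refine tendsto_nhdsWithin_of_tendsto_nhds ?_
      have : ContinuousAt (fun ρ : ℝ => (coeff w n : ℂ) * ((ρ : ℂ) * arc θ) ^ n) 1 := by fun_prop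
      simpa [ContinuousAt] using this
    · filter_upwards [eventually_radial hθ] with ρ hρ n
      rw [norm_mul, norm_pow]
      exact mul_le_of_le_one_right (norm_nonneg _) (pow_le_one₀ (norm_nonneg _) hρ.2.2.2.le)
  refine tendsto_nhds_unique h1 (h2.congr' ?_)
  filter_upwards [eventually_radial hθ] with ρ h3
  rw [A_eq_series hw.valid h3.2.2.1 h3.2.2.2, series]

lemma tendsto_A_arc {w : List Bool} (hw : IsAdm w) :
    Tendsto (fun θ => A w (arc θ)) (𝓝[>] 0) (𝓝 (T (revIndex w).reverse : ℂ)) := by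
  have hsum : Summable fun n => ‖(coeff w n : ℂ)‖ := by
    simpa using (summable_coeff hw).norm
  have h2 : Tendsto (fun θ : ℝ => ∑' n, (coeff w n : ℂ) * arc θ ^ n) (𝓝[>] 0)
      (𝓝 (∑' n, (coeff w n : ℂ))) := by
    refine tendsto_tsum_of_dominated_convergence hsum (fun n => ?_)
      (Eventually.of_forall fun θ n => ?_)
    · refine tendsto_nhdsWithin_of_tendsto_nhds ?_
      have : ContinuousAt (fun θ : ℝ => (coeff w n : ℂ) * (exp (θ * I)) ^ n) 0 := by fun_prop
      simpa [ContinuousAt, arc] using this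
    · rw [norm_mul, norm_pow, norm_arc, one_pow, mul_one]
  rw [T_index_eq_tsum hw.valid, Complex.ofReal_tsum]
  refine h2.congr' ?_
  filter_upwards [Ioo_mem_nhdsGT Real.pi_pos] with θ hθ
  exact (A_arc_eq_tsum hw hθ).symm

/-- The iterated integral on the arc, normalized so that it satisfies a real differential system.
-/
noncomputable def B (w : List Bool) (θ : ℝ) : ℂ := (-I) ^ w.count false * A w (arc θ)

/-- The real part of `B`. -/
noncomputable def X (w : List Bool) (θ : ℝ) : ℝ := (B w θ).re

/-- The imaginary part of `B`. -/
noncomputable def Y (w : List Bool) (θ : ℝ) : ℝ := (B w θ).im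

lemma X_nil (θ : ℝ) : X [] θ = 1 := by simp [X, B, A_nil]

lemma Y_nil (θ : ℝ) : Y [] θ = 0 := by simp [Y, B, A_nil]

/-- On the arc `(1 + t) / (1 - t)` is a positive multiple of `i`. -/
lemma Y_singleton_true {θ : ℝ} (hθ : θ ∈ Ioo 0 Real.pi) : Y [true] θ = Real.pi / 2 := by
  simp only [Y, B]
  have h0 := arc_mem_disc hθ
  rw [A_singleton_true h0]
  simp only [List.count_cons, List.count_nil]
  norm_num [Complex.log_im]
  rw [Complex.arg_eq_pi_div_two_iff, re_cayley, im_cayley, arc_re, arc_im]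
  refine ⟨by rw [Real.cos_sq_add_sin_sq]; simp, ?_⟩
  have := Real.sin_pos_of_mem_Ioo hθ
  have := normSq_one_sub_pos h0
  positivity

lemma hasDerivAt_B_false {w : List Bool} (hw : w ≠ []) {θ : ℝ} (hθ : θ ∈ Ioo 0 Real.pi) :
    HasDerivAt (B (false :: w)) (B w θ) θ := by
  have h := ((hasDerivAt_A_false hw (arc_mem_disc hθ) (arc_ne_zero θ)).comp θ
    (hasDerivAt_arc θ)).const_mul ((-I) ^ (false :: w).count false)
  convert! h using 1
  rw [B, List.count_cons_self, pow_succ]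
  have := arc_ne_zero θ
  field_simp
  rw [I_sq]; ring

lemma hasDerivAt_B_true (w : List Bool) {θ : ℝ} (hθ : θ ∈ Ioo 0 Real.pi) :
    HasDerivAt (B (true :: w)) (-(Real.sin θ : ℂ)⁻¹ * B w θ) θ := by
  have h := ((hasDerivAt_A_true w (arc_mem_disc hθ)).comp θ
    (hasDerivAt_arc θ)).const_mul ((-I) ^ (true :: w).count false)
  convert! h using 1
  have h1 : (1 : ℂ) - arc θ ^ 2 = -2 * I * Real.sin θ * arc θ := by
    have h2 : arc θ = Real.cos θ + Real.sin θ * I := by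
      apply Complex.ext <;> simp [arc_re, arc_im, -ofReal_cos, -ofReal_sin]
    rw [h2]
    have h3 : (Real.cos θ : ℂ) ^ 2 + (Real.sin θ : ℂ) ^ 2 = 1 := by
      exact_mod_cast Real.cos_sq_add_sin_sq θ
    linear_combination -h3 + (- (Real.sin θ : ℂ) ^ 2) * I_sq + 2 * (Real.sin θ : ℂ) ^ 2 * I_sq
  have h4 : (Real.sin θ : ℂ) ≠ 0 := by exact_mod_cast (Real.sin_pos_of_mem_Ioo hθ).ne'
  have h5 := arc_ne_zero θ
  rw [h1, B]
  have h6 : (true :: w).count false = w.count false := by simp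
  rw [h6]
  field_simp

lemma hasDerivAt_X_false {w : List Bool} (hw : w ≠ []) {θ : ℝ} (hθ : θ ∈ Ioo 0 Real.pi) :
    HasDerivAt (X (false :: w)) (X w θ) θ :=
  (reCLM.hasFDerivAt.comp_hasDerivAt θ (hasDerivAt_B_false hw hθ))

lemma hasDerivAt_Y_false {w : List Bool} (hw : w ≠ []) {θ : ℝ} (hθ : θ ∈ Ioo 0 Real.pi) :
    HasDerivAt (Y (false :: w)) (Y w θ) θ :=
  (imCLM.hasFDerivAt.comp_hasDerivAt θ (hasDerivAt_B_false hw hθ))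

lemma hasDerivAt_X_true (w : List Bool) {θ : ℝ} (hθ : θ ∈ Ioo 0 Real.pi) :
    HasDerivAt (X (true :: w)) (-(Real.sin θ)⁻¹ * X w θ) θ := by
  convert! (reCLM.hasFDerivAt.comp_hasDerivAt θ (hasDerivAt_B_true w hθ)) using 1
  rw [← ofReal_inv, ← ofReal_neg]
  simp [X, -ofReal_inv, -ofReal_neg]

lemma hasDerivAt_Y_true (w : List Bool) {θ : ℝ} (hθ : θ ∈ Ioo 0 Real.pi) :
    HasDerivAt (Y (true :: w)) (-(Real.sin θ)⁻¹ * Y w θ) θ := by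
  convert! (imCLM.hasFDerivAt.comp_hasDerivAt θ (hasDerivAt_B_true w hθ)) using 1
  rw [← ofReal_inv, ← ofReal_neg]
  simp [Y, -ofReal_inv, -ofReal_neg]

lemma B_pi_sub {w : List Bool} (hw : Valid w) {θ : ℝ} (hθ : θ ∈ Ioo 0 Real.pi) :
    B w (Real.pi - θ) = (-1) ^ w.length * (starRingEnd ℂ) (B w θ) := by
  rw [B, A_arc_pi_sub hw hθ, B, ← List.count_true_add_count_false w, pow_add, map_mul, map_pow,
    map_neg, conj_I, neg_neg, neg_pow I]
  ring

lemma X_pi_sub {w : List Bool} (hw : Valid w) {θ : ℝ} (hθ : θ ∈ Ioo 0 Real.pi) :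
    X w (Real.pi - θ) = (-1) ^ w.length * X w θ := by
  have : ((-1 : ℂ)) ^ w.length = (((-1 : ℝ) ^ w.length : ℝ) : ℂ) := by push_cast; rfl
  rw [X, B_pi_sub hw hθ, this, re_ofReal_mul, conj_re, X]

lemma Y_pi_sub {w : List Bool} (hw : Valid w) {θ : ℝ} (hθ : θ ∈ Ioo 0 Real.pi) :
    Y w (Real.pi - θ) = -((-1) ^ w.length * Y w θ) := by
  have : ((-1 : ℂ)) ^ w.length = (((-1 : ℝ) ^ w.length : ℝ) : ℂ) := by push_cast; rfl
  rw [Y, B_pi_sub hw hθ, this, im_ofReal_mul, conj_im, Y]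
  ring

lemma tendsto_B {w : List Bool} (hw : IsAdm w) :
    Tendsto (B w) (𝓝[>] 0) (𝓝 ((-I) ^ w.count false * (T (revIndex w).reverse : ℂ))) :=
  (tendsto_A_arc hw).const_mul _

lemma tendsto_X {w : List Bool} (hw : IsAdm w) :
    Tendsto (X w) (𝓝[>] 0) (𝓝 (((-I) ^ w.count false).re * T (revIndex w).reverse)) := by
  have := (continuous_re.tendsto _).comp (tendsto_B hw)
  rwa [re_mul_ofReal] at this

lemma tendsto_Y {w : List Bool} (hw : IsAdm w) :
    Tendsto (Y w) (𝓝[>] 0) (𝓝 (((-I) ^ w.count false).im * T (revIndex w).reverse)) := by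
  have := (continuous_im.tendsto _).comp (tendsto_B hw)
  rwa [im_mul_ofReal] at this

lemma B_true_mul {w : List Bool} (hw : Valid w) {θ : ℝ} (hθ : θ ∈ Ioo 0 Real.pi) :
    B [true] θ * B w θ = ((insertions w).map (B · θ)).sum := by
  have h1 : ∀ v ∈ insertions w, B v θ = (-I) ^ w.count false * A v (arc θ) := fun v hv => by
    rw [B, (mem_insertions hv).2.2]
  rw [List.map_congr_left h1, List.sum_map_mul_left, ← A_true_mul hw (arc_mem_disc hθ), B, B]
  simp
  ring

lemma X_true_mul_X {w : List Bool} (hw : Valid w) {θ : ℝ} (hθ : θ ∈ Ioo 0 Real.pi) :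
    X [true] θ * X w θ = ((insertions w).map (X · θ)).sum + Real.pi / 2 * Y w θ := by
  have h := congrArg reCLM (B_true_mul hw hθ)
  rw [map_list_sum, List.map_map] at h
  have h2 : (B [true] θ * B w θ).re = X [true] θ * X w θ - Real.pi / 2 * Y w θ := by
    rw [mul_re, ← Y_singleton_true hθ]; rfl
  have h3 : (B [true] θ * B w θ).re = ((insertions w).map (X · θ)).sum := h
  linarith

lemma X_true_mul_Y {w : List Bool} (hw : Valid w) {θ : ℝ} (hθ : θ ∈ Ioo 0 Real.pi) :
    X [true] θ * Y w θ + Real.pi / 2 * X w θ = ((insertions w).map (Y · θ)).sum := by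
  have h := congrArg imCLM (B_true_mul hw hθ)
  rw [map_list_sum, List.map_map] at h
  have h2 : (B [true] θ * B w θ).im = X [true] θ * Y w θ + Real.pi / 2 * X w θ := by
    rw [mul_im, ← Y_singleton_true hθ]; rfl
  have h3 : (B [true] θ * B w θ).im = ((insertions w).map (Y · θ)).sum := h
  linarith

lemma re_neg_I_pow {a : ℕ} (h : a % 2 = 1) : ((-I) ^ a).re = 0 := by
  obtain ⟨k, rfl⟩ : ∃ k, a = 2 * k + 1 := ⟨a / 2, by omega⟩
  rw [pow_succ, pow_mul, neg_sq, I_sq]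
  have : ((-1 : ℂ)) ^ k = (((-1 : ℝ) ^ k : ℝ) : ℂ) := by push_cast; rfl
  rw [this, re_ofReal_mul]; simp

lemma im_neg_I_pow {a : ℕ} (h : a % 2 = 0) : ((-I) ^ a).im = 0 := by
  obtain ⟨k, rfl⟩ : ∃ k, a = 2 * k := ⟨a / 2, by omega⟩
  rw [pow_mul, neg_sq, I_sq]
  have : ((-1 : ℂ)) ^ k = (((-1 : ℝ) ^ k : ℝ) : ℂ) := by push_cast; rfl
  rw [this, ofReal_im]

lemma re_neg_I_pow_even (k : ℕ) : ((-I) ^ (2 * k)).re = (-1) ^ k := by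
  rw [pow_mul, neg_sq, I_sq]
  have : ((-1 : ℂ)) ^ k = (((-1 : ℝ) ^ k : ℝ) : ℂ) := by push_cast; rfl
  rw [this, ofReal_re]

lemma im_neg_I_pow_odd (k : ℕ) : ((-I) ^ (2 * k + 1)).im = -(-1) ^ k := by
  rw [pow_succ, pow_mul, neg_sq, I_sq]
  have : ((-1 : ℂ)) ^ k = (((-1 : ℝ) ^ k : ℝ) : ℂ) := by push_cast; rfl
  rw [this, im_ofReal_mul]; simp

lemma exists_eq_add_const {f g h : ℝ → ℝ} (hf : ∀ θ ∈ Ioo 0 Real.pi, HasDerivAt f (h θ) θ)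
    (hg : ∀ θ ∈ Ioo 0 Real.pi, HasDerivAt g (h θ) θ) :
    ∃ c, ∀ θ ∈ Ioo 0 Real.pi, f θ = g θ + c :=
  isOpen_Ioo.exists_eq_add_of_deriv_eq isPreconnected_Ioo
    (fun θ hθ => (hf θ hθ).differentiableAt.differentiableWithinAt)
    (fun θ hθ => (hg θ hθ).differentiableAt.differentiableWithinAt)
    (fun θ hθ => by rw [(hf θ hθ).deriv, (hg θ hθ).deriv])

end

section

open Set Filter Topology

/-! ### Spans of powers of `π` times multiple `T`-values -/

/-- The rational span of the products of `π ^ j` with multiple `T`-values of total depth at most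
`m`, of total weight `N` (where `π` has weight `1`) and with `j ≡ p (mod 2)`. -/
noncomputable def piT (m p N : ℕ) : Submodule ℚ ℝ :=
  Submodule.span ℚ {x | ∃ (j : ℕ) (L : List (List ℕ)), (∀ k ∈ L, Admissible k) ∧
    (L.map depth).sum ≤ m ∧ j % 2 = p % 2 ∧ j + (L.map weight).sum = N ∧
    x = Real.pi ^ j * (L.map T).prod}

lemma piT_mono {m m' p N : ℕ} (h : m ≤ m') : piT m p N ≤ piT m' p N := by
  refine Submodule.span_mono ?_
  rintro x ⟨j, L, h1, h2, h3⟩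
  exact ⟨j, L, h1, h2.trans h, h3⟩

lemma piT_congr {m p p' N : ℕ} (h : p % 2 = p' % 2) : piT m p N = piT m p' N := by
  simp only [piT, h]

lemma mul_mem_piT {m m' p p' N N' : ℕ} {x y : ℝ} (hx : x ∈ piT m p N) (hy : y ∈ piT m' p' N') :
    x * y ∈ piT (m + m') (p + p') (N + N') := by
  unfold piT at hx hy
  induction hx using Submodule.span_induction with
  | zero => simp
  | add a b _ _ ha hb => rw [add_mul]; exact add_mem ha hb
  | smul c a _ ha => rw [smul_mul_assoc]; exact Submodule.smul_mem _ _ ha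
  | mem x hx =>
    induction hy using Submodule.span_induction with
    | zero => simp
    | add a b _ _ ha hb => rw [mul_add]; exact add_mem ha hb
    | smul c a _ ha => rw [mul_smul_comm]; exact Submodule.smul_mem _ _ ha
    | mem y hy =>
      obtain ⟨j, L, h1, h2, h3, h4, rfl⟩ := hx
      obtain ⟨j', L', h1', h2', h3', h4', rfl⟩ := hy
      refine Submodule.subset_span ⟨j + j', L ++ L', ?_, ?_, by omega, ?_, ?_⟩
      · intro k hk
        rcases List.mem_append.1 hk with h | h
        exacts [h1 k h, h1' k h]
      · simp only [List.map_append, List.sum_append]; omega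
      · simp only [List.map_append, List.sum_append]; omega
      · simp only [List.map_append, List.prod_append, pow_add]; ring

lemma pi_pow_mem_piT (j : ℕ) : Real.pi ^ j ∈ piT 0 j j :=
  Submodule.subset_span ⟨j, [], by simp, by simp, rfl, by simp, by simp⟩

lemma T_mem_piT {w : List Bool} (hw : IsAdm w) :
    T (revIndex w).reverse ∈ piT (w.count true) 0 w.length := by
  refine Submodule.subset_span ⟨0, [(revIndex w).reverse], ?_, ?_, rfl, ?_, by simp⟩
  · simpa using admissible_index hw
  · simp [depth, length_revIndex]
  · simp [weight, sum_revIndex hw.valid]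

lemma div_pi_mem_piT {m N : ℕ} {x : ℝ} (hx : x ∈ piT m 1 (N + 1)) : x / Real.pi ∈ piT m 0 N := by
  unfold piT at hx
  induction hx using Submodule.span_induction with
  | zero => simp
  | add a b _ _ ha hb => rw [add_div]; exact add_mem ha hb
  | smul c a _ ha => rw [smul_div_assoc]; exact Submodule.smul_mem _ _ ha
  | mem x hx =>
    obtain ⟨j, L, h1, h2, h3, h4, rfl⟩ := hx
    obtain ⟨j, rfl⟩ : ∃ i, j = i + 1 := ⟨j - 1, by omega⟩
    refine Submodule.subset_span ⟨j, L, h1, h2, by omega, by omega, ?_⟩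
    have := Real.pi_ne_zero
    rw [pow_succ]
    field_simp

lemma ratCast_mul_mem {S : Submodule ℚ ℝ} {x : ℝ} (q : ℚ) (hx : x ∈ S) : (q : ℝ) * x ∈ S := by
  rw [← Rat.smul_def]; exact S.smul_mem q hx

/-! ### Spaces of functions on the arc -/

/-- Functions of `θ` of depth `d` and weight `n`: the rational span of the functions `c * (θ - π /
2) ^ j * X u θ` in which the coefficient `c` has positive depth `e` and odd weight `N`. A
coefficient of depth `e` is built from `T`-values of total depth at most `e - 1` only, and the
exponents of `π` in it are congruent to `e` modulo `2`. If `adm` holds, the words `u` are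
admissible or empty, so that the functions have limits at `0`. -/
noncomputable def arcSpan (adm : Prop) (d n : ℕ) : Submodule ℚ (ℝ → ℝ) :=
  Submodule.span ℚ {f | ∃ (e N j : ℕ) (u : List Bool) (c : ℝ), 1 ≤ e ∧ N % 2 = 1 ∧ Valid u ∧
    (adm → u.head? ≠ some true) ∧ e + u.count true = d ∧ j + u.length + N = n ∧
    c ∈ piT (e - 1) e N ∧ f = fun θ => c * (θ - Real.pi / 2) ^ j * X u θ}

lemma arcSpan_mono {p q : Prop} (h : q → p) (d n : ℕ) : arcSpan p d n ≤ arcSpan q d n := by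
  refine Submodule.span_mono ?_
  rintro f ⟨e, N, j, u, c, h1, h2, h3, h4, h5⟩
  exact ⟨e, N, j, u, c, h1, h2, h3, fun hq => h4 (h hq), h5⟩

/-- Integration by parts, lowering the exponent of `θ - π / 2`. The words that arise begin with
`false`, even when `u` does not. -/
lemma exists_primitive_monomial (d n e N : ℕ) (he : 1 ≤ e) (hN : N % 2 = 1) (j : ℕ) (u : List Bool)
    (c : ℝ) (hu : Valid u) (hd : e + u.count true = d) (hn : j + u.length + N = n)
    (hc : c ∈ piT (e - 1) e N) :
    ∃ F ∈ arcSpan True d (n + 1), ∀ θ ∈ Ioo 0 Real.pi,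
      HasDerivAt F (c * (θ - Real.pi / 2) ^ j * X u θ) θ := by
  have hsub : ∀ (j : ℕ) (θ : ℝ), HasDerivAt (fun θ : ℝ => (θ - Real.pi / 2) ^ (j + 1))
      ((j + 1) * (θ - Real.pi / 2) ^ j) θ := by
    intro j θ
    simpa using ((hasDerivAt_id θ).sub_const (Real.pi / 2)).fun_pow (j + 1)
  by_cases hu0 : u = []
  · subst hu0
    refine ⟨fun θ => ((1 / (j + 1) : ℚ) : ℝ) * (c * (θ - Real.pi / 2) ^ (j + 1) * X [] θ), ?_, ?_⟩
    · have := (arcSpan True d (n + 1)).smul_mem (1 / (j + 1) : ℚ) (Submodule.subset_span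
        ⟨e, N, j + 1, [], c, he, hN, hu, by simp, hd, by omega, hc, rfl⟩)
      convert! this using 1
    · intro θ _
      simp only [X_nil, mul_one]
      convert! ((hsub j θ).const_mul c).const_mul ((1 / (j + 1) : ℚ) : ℝ) using 1
      have : (j : ℝ) + 1 ≠ 0 := by positivity
      push_cast
      field_simp
  · induction j generalizing n u with
    | zero =>
      refine ⟨fun θ => c * (θ - Real.pi / 2) ^ 0 * X (false :: u) θ, ?_, ?_⟩
      · exact Submodule.subset_span ⟨e, N, 0, false :: u, c, he, hN, (valid_cons hu0).2 hu,
          by simp, by simpa using hd, by simp; omega, hc, rfl⟩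
      · intro θ hθ
        simpa using (hasDerivAt_X_false hu0 hθ).const_mul c
    | succ j ih =>
      obtain ⟨F, hF, hF'⟩ := ih n (false :: u) ((valid_cons hu0).2 hu) (by simpa using hd)
        (by simp; omega) (by simp)
      refine ⟨(fun θ => c * (θ - Real.pi / 2) ^ (j + 1) * X (false :: u) θ) -
        ((j + 1 : ℕ) : ℚ) • F, ?_, ?_⟩
      · refine sub_mem (Submodule.subset_span ?_) (Submodule.smul_mem _ _ hF)
        exact ⟨e, N, j + 1, false :: u, c, he, hN, (valid_cons hu0).2 hu,
          by simp, by simpa using hd, by simp; omega, hc, rfl⟩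
      · intro θ hθ
        have h1 := (((hsub j θ).const_mul c).mul (hasDerivAt_X_false hu0 hθ)).sub
          ((hF' θ hθ).const_mul ((j : ℝ) + 1))
        convert! h1 using 1
        · ext x
          simp [Rat.smul_def]
        · ring

lemma exists_primitive {p : Prop} {d n : ℕ} {g : ℝ → ℝ} (hg : g ∈ arcSpan p d n) :
    ∃ F ∈ arcSpan True d (n + 1), ∀ θ ∈ Ioo 0 Real.pi, HasDerivAt F (g θ) θ := by
  unfold arcSpan at hg
  induction hg using Submodule.span_induction with
  | zero => exact ⟨0, zero_mem _, fun θ _ => hasDerivAt_const θ (0 : ℝ)⟩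
  | add a b _ _ ha hb =>
    obtain ⟨F, hF, hF'⟩ := ha
    obtain ⟨G, hG, hG'⟩ := hb
    exact ⟨F + G, add_mem hF hG, fun θ hθ => (hF' θ hθ).add (hG' θ hθ)⟩
  | smul c a _ ha =>
    obtain ⟨F, hF, hF'⟩ := ha
    exact ⟨c • F, Submodule.smul_mem _ _ hF, fun θ hθ => (hF' θ hθ).const_smul c⟩
  | mem x hx =>
    obtain ⟨e, N, j, u, c, h1, h2, h3, h4, h5, h6, h7, rfl⟩ := hx
    exact exists_primitive_monomial d n e N h1 h2 j u c h3 h5 h6 h7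

/-- The parity of the exponent of `π` is forced: `X u` has a nonzero limit only if `u` has an even
number of letters `false`. -/
lemma tendsto_of_mem_arcSpan {d n : ℕ} {g : ℝ → ℝ} (hg : g ∈ arcSpan True d n) :
    ∃ L ∈ piT (d - 1) (d + n + 1) n, Tendsto g (𝓝[>] 0) (𝓝 L) := by
  unfold arcSpan at hg
  induction hg using Submodule.span_induction with
  | zero => exact ⟨0, zero_mem _, tendsto_const_nhds⟩
  | add a b _ _ ha hb =>
    obtain ⟨F, hF, hF'⟩ := ha
    obtain ⟨G, hG, hG'⟩ := hb
    exact ⟨F + G, add_mem hF hG, hF'.add hG'⟩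
  | smul c a _ ha =>
    obtain ⟨F, hF, hF'⟩ := ha
    exact ⟨c • F, Submodule.smul_mem _ _ hF, hF'.const_smul c⟩
  | mem x hx =>
    obtain ⟨e, N, j, u, c, he, hN, hu, hadm, hd, hn, hc, rfl⟩ := hx
    have hpow : Tendsto (fun θ : ℝ => c * (θ - Real.pi / 2) ^ j) (𝓝[>] 0)
        (𝓝 (c * (-(Real.pi / 2)) ^ j)) := by
      refine tendsto_nhdsWithin_of_tendsto_nhds ?_
      have : ContinuousAt (fun θ : ℝ => c * (θ - Real.pi / 2) ^ j) 0 := by fun_prop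
      simpa [ContinuousAt] using this
    have hpowmem : c * (-(Real.pi / 2)) ^ j ∈ piT (e - 1) (e + j) (N + j) := by
      have h := ratCast_mul_mem ((-1 / 2 : ℚ) ^ j) (mul_mem_piT hc (pi_pow_mem_piT j))
      convert! h using 1
      push_cast
      rw [← neg_div, div_pow, div_pow, neg_pow Real.pi]
      ring
    by_cases hu0 : u = []
    · subst hu0
      simp only [List.count_nil, List.length_nil, add_zero] at hd hn
      refine ⟨c * (-(Real.pi / 2)) ^ j, ?_, by simpa [X_nil] using hpow⟩
      rw [piT_congr (p' := e + j) (by omega), ← hd, ← hn, add_comm j N]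
      exact hpowmem
    · have huA : IsAdm u := by
        refine ⟨hu, ?_⟩
        match u, hu0, hadm trivial with
        | true :: _, _, h => simp at h
        | false :: _, _, _ => rfl
      refine ⟨_, ?_, hpow.mul (tendsto_X huA)⟩
      by_cases ha : u.count false % 2 = 1
      · rw [re_neg_I_pow ha]; simp
      · obtain ⟨k, hk⟩ : ∃ k, u.count false = 2 * k := ⟨u.count false / 2, by omega⟩
        rw [hk, re_neg_I_pow_even]
        have h := ratCast_mul_mem ((-1 : ℚ) ^ k) (mul_mem_piT hpowmem (T_mem_piT huA))
        have hlen := List.count_true_add_count_false u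
        have e1 : e - 1 + u.count true = d - 1 := by omega
        have e2 : N + j + u.length = n := by omega
        rw [e1, e2, piT_congr (p' := d + n + 1) (by omega)] at h
        convert! h using 1
        push_cast
        ring

lemma pi_sub_of_mem_arcSpan {p : Prop} {d n : ℕ} {g : ℝ → ℝ} (hg : g ∈ arcSpan p d n) :
    ∀ θ ∈ Ioo 0 Real.pi, g (Real.pi - θ) = -((-1) ^ n * g θ) := by
  intro θ hθ
  unfold arcSpan at hg
  induction hg using Submodule.span_induction with
  | zero => simp
  | add a b _ _ ha hb => simp only [Pi.add_apply, ha, hb]; ring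
  | smul c a _ ha => simp only [Pi.smul_apply, Rat.smul_def, ha]; ring
  | mem x hx =>
    obtain ⟨e, N, j, u, c, he, hN, hu, hadm, hd, hn, hc, rfl⟩ := hx
    have h1 : Real.pi - θ - Real.pi / 2 = -1 * (θ - Real.pi / 2) := by ring
    have h2 : (-1 : ℝ) ^ N = -1 := by
      rw [neg_one_pow_eq_pow_mod_two, hN, pow_one]
    simp only [X_pi_sub hu hθ, h1, mul_pow]
    rw [← hn, pow_add, pow_add, h2]
    ring

lemma const_mul_pow_mem_arcSpan {d n : ℕ} {c : ℝ} (j : ℕ) (hd : 1 ≤ d) (hn : n % 2 = 1)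
    (hc : c ∈ piT (d - 1) d n) :
    (fun θ : ℝ => c * (θ - Real.pi / 2) ^ j) ∈ arcSpan True d (n + j) :=
  Submodule.subset_span ⟨d, n, j, [], c, hd, hn, valid_nil, by simp, by simp,
    by simp [add_comm], hc, by simp [X_nil]⟩

/-- Membership up to equality on the open arc. -/
def InArcSpan (p : Prop) (d n : ℕ) (f : ℝ → ℝ) : Prop :=
  ∃ g ∈ arcSpan p d n, EqOn f g (Ioo 0 Real.pi)

lemma InArcSpan.add {p : Prop} {d n : ℕ} {f g : ℝ → ℝ} (hf : InArcSpan p d n f)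
    (hg : InArcSpan p d n g) : InArcSpan p d n (fun θ => f θ + g θ) := by
  obtain ⟨f', hf', h1⟩ := hf
  obtain ⟨g', hg', h2⟩ := hg
  exact ⟨f' + g', add_mem hf' hg', fun θ hθ => by simp [h1 hθ, h2 hθ]⟩

lemma InArcSpan.const_mul {p : Prop} {d n : ℕ} {f : ℝ → ℝ} (q : ℚ) (hf : InArcSpan p d n f) :
    InArcSpan p d n (fun θ => (q : ℝ) * f θ) := by
  obtain ⟨f', hf', h1⟩ := hf
  exact ⟨q • f', Submodule.smul_mem _ _ hf', fun θ hθ => by simp [h1 hθ, Rat.smul_def]⟩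

lemma InArcSpan.list_sum {p : Prop} {d n : ℕ} {F : List Bool → ℝ → ℝ} (l : List (List Bool))
    (h : ∀ v ∈ l, InArcSpan p d n (F v)) : InArcSpan p d n (fun θ => (l.map (F · θ)).sum) := by
  induction l with
  | nil => exact ⟨0, zero_mem _, fun θ _ => by simp⟩
  | cons v l ih =>
    simp only [List.map_cons, List.sum_cons]
    exact (h v (by simp)).add (ih fun u hu => h u (by simp [hu]))

lemma InArcSpan.congr {p : Prop} {d n : ℕ} {f g : ℝ → ℝ} (hf : InArcSpan p d n f)
    (h : EqOn g f (Ioo 0 Real.pi)) : InArcSpan p d n g := by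
  obtain ⟨f', hf', h1⟩ := hf
  exact ⟨f', hf', h.trans h1⟩

/-- The factor `π` makes up for the depth: the product of coefficients of depths `e` and `e'` is
built from values of total depth at most `e + e' - 2`, and is used as a coefficient of depth `e +
e' + 1`. -/
lemma mul_mem_arcSpan {p : Prop} {d n e N j : ℕ} {c : ℝ} {g : ℝ → ℝ} (he : 1 ≤ e) (hN : N % 2 = 1)
    (hc : c ∈ piT (e - 1) e N) (hg : g ∈ arcSpan p d n) :
    (fun θ => c * Real.pi * (θ - Real.pi / 2) ^ j * g θ) ∈ arcSpan p (e + d + 1) (N + j + n + 1) := by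
  unfold arcSpan at hg
  induction hg using Submodule.span_induction with
  | zero => convert! zero_mem (arcSpan p _ _) using 1; ext; simp
  | add a b _ _ ha hb => convert! add_mem ha hb using 1; ext; simp; ring
  | smul q a _ ha =>
    convert! Submodule.smul_mem _ q ha using 1; ext; simp [Rat.smul_def]; ring
  | mem x hx =>
    obtain ⟨e', N', j', u, c', he', hN', hu, hadm, hd, hn, hc', rfl⟩ := hx
    refine Submodule.subset_span ⟨e + e' + 1, N + N' + 1, j + j', u, c * Real.pi * c', by omega,
      by omega, hu, hadm, by omega, by omega, ?_, ?_⟩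
    · have h := mul_mem_piT (mul_mem_piT hc (pi_pow_mem_piT 1)) hc'
      rw [pow_one] at h
      rw [piT_congr (p' := e + 1 + e') (by omega), show N + N' + 1 = N + 1 + N' by omega]
      exact piT_mono (by omega) h
    · ext θ; ring

/-- The product `X [true] * X u` is a sum of functions `X v` plus a multiple of `Y u`, by the
shuffle product. -/
lemma InArcSpan.X_true_mul {d n : ℕ} {f : ℝ → ℝ} (hf : InArcSpan False d n f)
    (hY : ∀ u : List Bool, Valid u → u.length < n →
      InArcSpan False (u.count true) u.length (Y u)) :
    InArcSpan False (d + 1) (n + 1) (fun θ => X [true] θ * f θ) := by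
  obtain ⟨g, hg, hfg⟩ := hf
  suffices h : InArcSpan False (d + 1) (n + 1) (fun θ => X [true] θ * g θ) from
    h.congr fun θ hθ => by simp only [hfg hθ]
  clear hfg
  unfold arcSpan at hg
  induction hg using Submodule.span_induction with
  | zero => exact ⟨0, zero_mem _, fun θ _ => by simp⟩
  | add a b _ _ ha hb => exact (ha.add hb).congr fun θ _ => by simp [mul_add]
  | smul q a _ ha =>
    exact (ha.const_mul q).congr fun θ _ => by simp [Rat.smul_def]; ring
  | mem x hx =>
    obtain ⟨e, N, j, u, c, he, hN, hu, -, hd, hn, hc, rfl⟩ := hx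
    have h1 : InArcSpan False (d + 1) (n + 1) (fun θ => ((insertions u).map fun v =>
        c * (θ - Real.pi / 2) ^ j * X v θ).sum) := by
      refine InArcSpan.list_sum (F := fun v θ => c * (θ - Real.pi / 2) ^ j * X v θ) _ fun v hv => ?_
      obtain ⟨k1, k2, -⟩ := mem_insertions hv
      exact ⟨_, Submodule.subset_span ⟨e, N, j, v, c, he, hN, valid_of_mem_insertions hu hv,
        by simp, by omega, by omega, hc, rfl⟩, fun θ _ => rfl⟩
    obtain ⟨g, hg, hgu⟩ := hY u hu (by omega)
    have h2 := mul_mem_arcSpan (j := j) he hN hc hg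
    rw [show e + u.count true + 1 = d + 1 by omega,
      show N + j + u.length + 1 = n + 1 by omega] at h2
    have h3 : InArcSpan False (d + 1) (n + 1)
        (fun θ => ((1 / 2 : ℚ) : ℝ) * (c * Real.pi * (θ - Real.pi / 2) ^ j * g θ)) :=
      InArcSpan.const_mul _ ⟨_, h2, fun θ _ => rfl⟩
    refine (h1.add h3).congr fun θ hθ => ?_
    simp only
    rw [List.sum_map_mul_left]
    have h4 := X_true_mul_X hu hθ
    rw [hgu hθ] at h4
    push_cast
    linear_combination (c * (θ - Real.pi / 2) ^ j) * h4

/-! ### The imaginary parts are of lower depth -/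

/-- The number of letters `true` at the head of a word. -/
def leadingTrue : List Bool → ℕ
  | true :: w => leadingTrue w + 1
  | _ => 0

lemma leadingTrue_le_of_mem_insertions {w v : List Bool} (hv : v ∈ insertions w) :
    v = true :: w ∨ leadingTrue v ≤ leadingTrue w := by
  induction w generalizing v with
  | nil => simp [insertions] at hv; simp [hv]
  | cons x w ih =>
    simp only [insertions, List.mem_cons, List.mem_map] at hv
    rcases hv with rfl | ⟨u, hu, rfl⟩
    · exact Or.inl rfl
    · cases x
      · right; simp [leadingTrue]
      · rcases ih hu with rfl | h
        · exact Or.inl rfl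
        · right; simpa [leadingTrue] using h

lemma list_sum_eq_count_mul (F : List Bool → ℝ) (v : List Bool) (l : List (List Bool)) :
    (l.map F).sum = l.count v * F v + ((l.filter (· ≠ v)).map F).sum := by
  induction l with
  | nil => simp
  | cons u l ih =>
    by_cases h : u = v
    · subst h
      simp [ih]; ring
    · simp [ih, h]; ring

/-- Shuffling `[true]` with `w` gives a positive multiple of `true :: w` and words with fewer
leading letters `true`; this replaces a regularization at `t = 1`. -/
lemma Y_true_inArcSpan {w : List Bool} (hw : Valid w)
    (hlen : ∀ u : List Bool, Valid u → u.length < w.length + 1 →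
      InArcSpan False (u.count true) u.length (Y u))
    (hlead : ∀ u : List Bool, Valid u → u.length = w.length + 1 →
      leadingTrue u < leadingTrue (true :: w) → InArcSpan False (u.count true) u.length (Y u)) :
    InArcSpan False (w.count true + 1) (w.length + 1) (Y (true :: w)) := by
  have h1 : InArcSpan False (w.count true + 1) (w.length + 1) (fun θ => X [true] θ * Y w θ) :=
    (hlen w hw (by omega)).X_true_mul fun u hu h => hlen u hu (by omega)
  have h2 : InArcSpan False (w.count true + 1) (w.length + 1) (fun θ => Real.pi * X w θ) :=
    ⟨_, Submodule.subset_span ⟨1, 1, 0, w, Real.pi, le_rfl, rfl, hw, by simp, by omega, by omega,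
      by simpa using pi_pow_mem_piT 1, rfl⟩, fun θ _ => by simp⟩
  set l := insertions w with hl
  have h3 : InArcSpan False (w.count true + 1) (w.length + 1)
      (fun θ => ((l.filter (· ≠ true :: w)).map (Y · θ)).sum) := by
    refine InArcSpan.list_sum _ fun v hv => ?_
    rw [List.mem_filter] at hv
    obtain ⟨k1, k2, -⟩ := mem_insertions hv.1
    rw [← k1, ← k2]
    refine hlead v (valid_of_mem_insertions hw hv.1) k1 ?_
    rcases leadingTrue_le_of_mem_insertions hv.1 with h | h
    · simp [h] at hv
    · simpa [leadingTrue] using Nat.lt_succ_of_le h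
  have hcount : 0 < l.count (true :: w) := by
    rw [List.count_pos_iff, hl]
    cases w <;> simp [insertions]
  have h4 := ((h1.add (h2.const_mul (1 / 2))).add (h3.const_mul (-1))).const_mul
    (1 / (l.count (true :: w) : ℚ))
  refine h4.congr fun θ hθ => ?_
  have h5 := X_true_mul_Y hw hθ
  rw [← hl, list_sum_eq_count_mul (Y · θ) (true :: w)] at h5
  have hc : (l.count (true :: w) : ℝ) ≠ 0 := by exact_mod_cast hcount.ne'
  push_cast
  field_simp
  linear_combination -2 * h5

/-- Integration in `θ`; the work is to control the constant of integration `c`. -/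
lemma Y_false_inArcSpan {w : List Bool} (hw : Valid (false :: w))
    (h : InArcSpan False (w.count true) w.length (Y w)) :
    InArcSpan True (w.count true) (w.length + 1) (Y (false :: w)) := by
  obtain ⟨g, hg, hgw⟩ := h
  obtain ⟨F, hF, hF'⟩ := exists_primitive hg
  have hne := hw.ne_nil
  have hlen0 : 1 ≤ w.length := List.length_pos_iff.2 hne
  have hd1 : 1 ≤ w.count true := by
    rw [Nat.one_le_iff_ne_zero, Ne, List.count_eq_zero]
    intro hm
    apply hw.tail
    rw [List.getLast?_eq_getLast_of_ne_nil hne]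
    rcases h : w.getLast hne with _ | _
    · rfl
    · exact absurd (h ▸ List.getLast_mem hne) hm
  obtain ⟨c, hc⟩ := exists_eq_add_const (f := Y (false :: w)) (g := F) (h := g)
    (fun θ hθ => by rw [← hgw hθ]; exact hasDerivAt_Y_false hne hθ) hF'
  have hadm : IsAdm (false :: w) := ⟨hw, rfl⟩
  have hwl := List.count_true_add_count_false w
  have hhalf : Real.pi / 2 ∈ Ioo 0 Real.pi := ⟨by positivity, by linarith [Real.pi_pos]⟩
  -- In even weight both functions are odd about `π / 2`, so the constant vanishes.
  rcases Nat.mod_two_eq_zero_or_one (w.length + 1) with hpar | hpar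
  · have h1 : (-1 : ℝ) ^ (w.length + 1) = 1 := by rw [neg_one_pow_eq_pow_mod_two, hpar, pow_zero]
    have h2 := pi_sub_of_mem_arcSpan hF _ hhalf
    have h3 := Y_pi_sub hw hhalf
    have h4 := hc _ hhalf
    rw [List.length_cons, h1] at h3
    rw [h1] at h2
    rw [show Real.pi - Real.pi / 2 = Real.pi / 2 by ring] at h2 h3
    have hc0 : c = 0 := by linarith
    exact ⟨F, hF, fun θ hθ => by rw [hc θ hθ, hc0, add_zero]⟩
  · suffices hcm : c ∈ piT (w.count true - 1) (w.count true) (w.length + 1) by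
      refine ⟨_, add_mem hF (const_mul_pow_mem_arcSpan 0 hd1 hpar hcm), fun θ hθ => ?_⟩
      simp [hc θ hθ]
    -- In even depth the limit of `Y (false :: w)` at `0` is unknown, but
    -- `Y (false :: false :: w)` tends to `0` and has no constant of integration; this determines `c * π / 2`.
    rcases Nat.mod_two_eq_zero_or_one (w.count true) with hd | hd
    · obtain ⟨F2, hF2, hF2'⟩ := exists_primitive hF
      obtain ⟨c2, hc2⟩ := exists_eq_add_const (f := Y (false :: false :: w))
        (g := fun θ => F2 θ + c * (θ - Real.pi / 2)) (h := fun θ => F θ + c)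
        (fun θ hθ => by
          rw [← hc θ hθ]; exact hasDerivAt_Y_false (by simp) hθ)
        (fun θ hθ => by
          simpa using (hF2' θ hθ).fun_add (((hasDerivAt_id θ).sub_const (Real.pi / 2)).const_mul c))
      have hw2 : Valid (false :: false :: w) := (valid_cons (by simp)).2 hw
      have h1 : (-1 : ℝ) ^ (w.length + 1 + 1) = 1 := by
        rw [neg_one_pow_eq_pow_mod_two, show (w.length + 1 + 1) % 2 = 0 by omega, pow_zero]
      have h2 := pi_sub_of_mem_arcSpan hF2 _ hhalf
      have h3 := Y_pi_sub hw2 hhalf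
      have h4 := hc2 _ hhalf
      rw [List.length_cons, List.length_cons, h1] at h3
      rw [h1] at h2
      rw [show Real.pi - Real.pi / 2 = Real.pi / 2 by ring] at h2 h3
      have hc0 : c2 = 0 := by
        rw [sub_self, mul_zero] at h4
        linarith
      obtain ⟨L, hL, hlim⟩ := tendsto_of_mem_arcSpan hF2
      have h5 := tendsto_Y (w := false :: false :: w) ⟨hw2, rfl⟩
      rw [im_neg_I_pow (by simp; omega), zero_mul] at h5
      have h6 : Tendsto (fun θ : ℝ => F2 θ + c * (θ - Real.pi / 2)) (𝓝[>] 0)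
          (𝓝 (L + c * (0 - Real.pi / 2))) := by
        refine hlim.add (tendsto_nhdsWithin_of_tendsto_nhds ?_)
        have : ContinuousAt (fun θ : ℝ => c * (θ - Real.pi / 2)) 0 := by fun_prop
        exact this
      have h7 := tendsto_nhds_unique (h5.congr' (by
        filter_upwards [Ioo_mem_nhdsGT Real.pi_pos] with θ hθ
        rw [hc2 θ hθ, hc0, add_zero])) h6
      have h8 : c = ((2 : ℚ) : ℝ) * (L / Real.pi) := by
        have := Real.pi_ne_zero
        push_cast
        field_simp
        linarith
      rw [h8, piT_congr (p' := 0) hd]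
      refine ratCast_mul_mem _ (div_pi_mem_piT ?_)
      rwa [piT_congr (p' := 1) (by omega)] at hL
    -- In odd depth `Y (false :: w)` itself tends to `0`.
    · obtain ⟨L, hL, hlim⟩ := tendsto_of_mem_arcSpan hF
      have h5 := tendsto_Y hadm
      rw [im_neg_I_pow (by simp; omega), zero_mul] at h5
      have h7 := tendsto_nhds_unique (h5.congr' (by
        filter_upwards [Ioo_mem_nhdsGT Real.pi_pos] with θ hθ
        exact hc θ hθ)) (hlim.add_const c)
      have h8 : c = -L := by linarith
      rw [h8, piT_congr (p' := w.count true + (w.length + 1) + 1) (by omega)]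
      exact neg_mem hL

lemma Y_inArcSpan (w : List Bool) (hw : Valid w) :
    InArcSpan False (w.count true) w.length (Y w) := by
  induction hn : w.length using Nat.strong_induction_on generalizing w with
  | _ n ihn =>
  induction hm : leadingTrue w using Nat.strong_induction_on generalizing w with
  | _ m ihm =>
  subst hn hm
  match w, hw with
  | [], _ => exact ⟨0, zero_mem _, fun θ _ => Y_nil θ⟩
  | true :: w, hw =>
    rw [List.count_cons_self]
    refine Y_true_inArcSpan hw.tail (fun u hu h => ihn _ h u hu rfl) (fun u hu h1 h2 => ?_)
    rw [h1]
    exact ihm _ h2 u hu h1 rfl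
  | false :: w, hw =>
    obtain ⟨g, hg, h⟩ := Y_false_inArcSpan hw (ihn _ (by simp) w hw.tail rfl)
    rw [List.count_cons_of_ne (by simp)]
    exact ⟨g, arcSpan_mono (by simp) _ _ hg, h⟩

/-- An odd number of letters `false` means that depth and weight have different parity. -/
lemma T_mem_piT_of_odd {w : List Bool} (hw : IsAdm w) (h : w.count false % 2 = 1) :
    T (revIndex w).reverse ∈ piT (w.count true - 1) 0 w.length := by
  have hlen := List.count_true_add_count_false w
  obtain ⟨w', rfl, hv, hne⟩ := hw.exists_eq
  obtain ⟨g, hg, hgw⟩ := Y_false_inArcSpan hw.valid (Y_inArcSpan w' hv)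
  obtain ⟨L, hL, hlim⟩ := tendsto_of_mem_arcSpan hg
  obtain ⟨k, hk⟩ : ∃ k, (false :: w').count false = 2 * k + 1 :=
    ⟨(false :: w').count false / 2, by omega⟩
  have h1 := tendsto_Y hw
  rw [hk, im_neg_I_pow_odd] at h1
  have h2 := tendsto_nhds_unique (h1.congr' (by
    filter_upwards [Ioo_mem_nhdsGT Real.pi_pos] with θ hθ
    exact hgw hθ)) hlim
  have h3 : T (revIndex (false :: w')).reverse = ((-(-1) ^ k : ℚ) : ℝ) * L := by
    rw [← h2]
    push_cast
    rw [← mul_assoc, neg_mul_neg, ← mul_pow]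
    simp
  rw [h3]
  refine ratCast_mul_mem _ ?_
  rw [List.count_cons_of_ne (by simp), List.length_cons] at hlen ⊢
  rwa [piT_congr (p' := 0) (by omega)] at hL

/-! ### Even powers of `π` -/

lemma T_singleton (n : ℕ) : T [n] = ∑' m, indexCoeff [n] m := T_reverse_eq_tsum [n]

lemma indexCoeff_singleton (k m : ℕ) :
    indexCoeff [k] m = if m % 2 = 1 then 2 / (m : ℝ) ^ k else 0 := by
  simp only [indexCoeff, Finset.sum_ite_eq', Finset.mem_filter, Finset.mem_range, zero_add]
  split_ifs with h1 h2 h2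
  · rw [mul_one]
  · exact absurd h1.2 h2
  · exact absurd ⟨by omega, h2⟩ h1
  · rw [mul_zero]

lemma T_singleton_eq_zeta {k : ℕ} (hk : 2 ≤ k) :
    T [k] = (2 ^ k - 1) * (2 * ∑' n : ℕ, 1 / (n : ℝ) ^ k) / 2 ^ k := by
  have hs : Summable fun n : ℕ => 2 / (n : ℝ) ^ k := by
    simpa [div_eq_mul_one_div (2 : ℝ)] using (Real.summable_one_div_nat_pow.2 hk).mul_left 2
  have hinj0 : Function.Injective fun n : ℕ => 2 * n := fun a b h => by simpa using h
  have hinj1 : Function.Injective fun n : ℕ => 2 * n + 1 := fun a b h => by simpa using h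
  have h1 := tsum_even_add_odd (f := fun n : ℕ => 2 / (n : ℝ) ^ k) (hs.comp_injective hinj0)
    (hs.comp_injective hinj1)
  have hf : Summable (indexCoeff [k]) := hs.of_nonneg_of_le (indexCoeff_nonneg _) fun n => by
    rw [indexCoeff_singleton]; split_ifs
    · rfl
    · positivity
  have h2 := tsum_even_add_odd (f := indexCoeff [k]) (hf.comp_injective hinj0)
    (hf.comp_injective hinj1)
  have h3 : ∀ n : ℕ, indexCoeff [k] (2 * n) = 0 := fun n => by
    rw [indexCoeff_singleton, if_neg (by omega)]
  have h4 : ∀ n : ℕ, indexCoeff [k] (2 * n + 1) = 2 / ((2 * n + 1 : ℕ) : ℝ) ^ k := fun n => by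
    rw [indexCoeff_singleton, if_pos (by omega)]
  have h5 : ∀ n : ℕ, 2 / ((2 * n : ℕ) : ℝ) ^ k = 1 / 2 ^ k * (2 / (n : ℝ) ^ k) := fun n => by
    push_cast; rw [mul_pow]; field_simp
  simp only [h3, h4, tsum_zero, zero_add] at h2
  simp only [h5] at h1
  rw [tsum_mul_left, h2, ← T_singleton] at h1
  have h6 : ∑' n : ℕ, 2 / (n : ℝ) ^ k = 2 * ∑' n : ℕ, 1 / (n : ℝ) ^ k := by
    rw [← tsum_mul_left]; exact tsum_congr fun n => by ring
  rw [h6] at h1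
  field_simp
  field_simp at h1
  linarith

/-- Euler's formula for the zeta values at even integers. -/
lemma T_even {l : ℕ} (hl : l ≠ 0) :
    T [2 * l] / (2 ^ (2 * l) - 1) =
      (-1) ^ (l + 1) * Real.pi ^ (2 * l) * (bernoulli (2 * l) : ℝ) / (2 * l).factorial := by
  rw [T_singleton_eq_zeta (by omega), (hasSum_zeta_nat hl).tsum_eq]
  have h1 : (2 : ℝ) ^ (2 * l) - 1 ≠ 0 := by
    have : (1 : ℝ) < 2 ^ (2 * l) := one_lt_pow₀ (by norm_num) (by omega)
    linarith
  have h2 : (2 : ℝ) ^ (2 * l) = 2 * 2 ^ (2 * l - 1) := by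
    rw [← pow_succ']; congr 1; omega
  field_simp
  rw [h2]

lemma T_singleton_pos {k : ℕ} (hk : 2 ≤ k) : 0 < T [k] := by
  have hs : Summable fun n : ℕ => 1 / (n : ℝ) ^ k := Real.summable_one_div_nat_pow.2 hk
  have h1 : 0 < ∑' n : ℕ, 1 / (n : ℝ) ^ k := hs.tsum_pos (fun n => by positivity) 1 (by simp)
  have h2 : (1 : ℝ) < 2 ^ k := one_lt_pow₀ (by norm_num) (by omega)
  rw [T_singleton_eq_zeta hk]
  have : (0 : ℝ) < 2 ^ k - 1 := by linarith
  positivity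

lemma exists_pi_pow_eq {l : ℕ} (hl : l ≠ 0) : ∃ q : ℚ, Real.pi ^ (2 * l) = q * T [2 * l] := by
  have h := T_even hl
  have hT := T_singleton_pos (k := 2 * l) (by omega)
  have h1 : (0 : ℝ) < 2 ^ (2 * l) - 1 := by
    have : (1 : ℝ) < 2 ^ (2 * l) := one_lt_pow₀ (by norm_num) (by omega)
    linarith
  have hb : (bernoulli (2 * l) : ℝ) ≠ 0 := by
    intro hb
    rw [hb] at h
    have : 0 < T [2 * l] / (2 ^ (2 * l) - 1) := by positivity
    simp [h] at this
  refine ⟨(-1) ^ (l + 1) * (2 * l).factorial / ((2 ^ (2 * l) - 1) * bernoulli (2 * l)), ?_⟩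
  push_cast
  have h2 : ((-1 : ℝ) ^ (l + 1)) * (-1) ^ (l + 1) = 1 := by rw [← mul_pow]; simp
  have h3 : T [2 * l] = (2 ^ (2 * l) - 1) *
      ((-1) ^ (l + 1) * Real.pi ^ (2 * l) * (bernoulli (2 * l) : ℝ) / (2 * l).factorial) := by
    rw [← h]; field_simp
  have h4 : ((2 * l).factorial : ℝ) ≠ 0 := by positivity
  rw [h3]
  field_simp
  linear_combination -h2

lemma piT_le_span {d n : ℕ} (hd : 2 ≤ d) (hn : 1 ≤ n) :
    piT (d - 1) 0 n ≤ Submodule.span ℚ (lowerDepthValues d ∪ productValues d) := by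
  refine Submodule.span_le.2 ?_
  rintro x ⟨j, L, hL, hdep, hj, hw, rfl⟩
  obtain ⟨l, rfl⟩ : ∃ l, j = 2 * l := ⟨j / 2, by omega⟩
  by_cases hl : l = 0
  · subst hl
    match L, hL, hdep, hw with
    | [], _, _, hw => simp at hw; omega
    | [k], hL, hdep, _ =>
      refine Submodule.subset_span (Or.inl ⟨k, hL k (by simp), ?_, by simp⟩)
      simp at hdep; omega
    | k :: k' :: L, hL, hdep, _ =>
      exact Submodule.subset_span (Or.inr ⟨k :: k' :: L, by simp, hL, by omega, by simp⟩)
  · obtain ⟨q, hq⟩ := exists_pi_pow_eq hl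
    have hadm : Admissible [2 * l] := ⟨by simp; omega, by simp, by simp; omega⟩
    rw [hq, mul_assoc]
    refine ratCast_mul_mem _ ?_
    match L, hL, hdep with
    | [], _, _ =>
      exact Submodule.subset_span (Or.inl ⟨[2 * l], hadm, by simp [depth]; omega, by simp⟩)
    | k :: L, hL, hdep =>
      refine Submodule.subset_span (Or.inr ⟨[2 * l] :: k :: L, by simp, ?_, ?_, by simp⟩)
      · intro k' hk'
        rcases List.mem_cons.1 hk' with rfl | h
        exacts [hadm, hL _ h]
      · rw [List.map_cons, List.sum_cons]
        simp only [depth, List.length_singleton] at hdep ⊢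
        omega

theorem T_mem_span {k : List ℕ} (hk : Admissible k) (hd : 2 ≤ depth k)
    (hpar : ¬ (depth k ≡ weight k [MOD 2])) :
    T k ∈ Submodule.span ℚ (lowerDepthValues (depth k) ∪ productValues (depth k)) := by
  obtain ⟨w, hw, rfl⟩ := exists_word_of_admissible hk
  have h1 : depth (revIndex w).reverse = w.count true := by simp [depth, length_revIndex]
  have h2 : weight (revIndex w).reverse = w.length := by simp [weight, sum_revIndex hw.valid]
  rw [h1] at hd hpar ⊢
  rw [h2] at hpar
  have hlen := List.count_true_add_count_false w
  unfold Nat.ModEq at hpar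
  exact piT_le_span hd (by omega) (T_mem_piT_of_odd hw (by omega))

end

section

open Set Filter Topology

/-! ### The explicit formula in depth two -/

/-- The word of the index `(m + 1)`. -/
def oneWord (m : ℕ) : List Bool := List.replicate m false ++ [true]

/-- The word of the index `(m + 1, n + 1)`. -/
def twoWord (n m : ℕ) : List Bool := List.replicate n false ++ true :: oneWord m

lemma oneWord_succ (m : ℕ) : oneWord (m + 1) = false :: oneWord m := rfl

lemma twoWord_succ (n m : ℕ) : twoWord (n + 1) m = false :: twoWord n m := rfl

lemma oneWord_ne_nil (m : ℕ) : oneWord m ≠ [] := by simp [oneWord]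

lemma twoWord_ne_nil (n m : ℕ) : twoWord n m ≠ [] := by simp [twoWord]

lemma valid_oneWord (m : ℕ) : Valid (oneWord m) := by simp [Valid, oneWord]

lemma valid_twoWord (n m : ℕ) : Valid (twoWord n m) := by
  induction n with
  | zero => exact valid_true_cons (valid_oneWord m)
  | succ n ih => exact (valid_cons (twoWord_ne_nil n m)).2 ih

lemma length_oneWord (m : ℕ) : (oneWord m).length = m + 1 := by simp [oneWord]

lemma length_twoWord (n m : ℕ) : (twoWord n m).length = n + m + 2 := by
  simp [twoWord, length_oneWord]; omega

lemma count_oneWord (m : ℕ) : (oneWord m).count false = m := by simp [oneWord]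

lemma count_twoWord (n m : ℕ) : (twoWord n m).count false = n + m := by
  simp [twoWord, count_oneWord]

lemma revIndex_oneWord (m : ℕ) : revIndex (oneWord m) = [m + 1] := by
  induction m with
  | zero => rfl
  | succ m ih => rw [oneWord_succ, revIndex, ih]; rfl

lemma revIndex_twoWord (n m : ℕ) : revIndex (twoWord n m) = [n + 1, m + 1] := by
  induction n with
  | zero => simp [twoWord, revIndex, revIndex_oneWord]
  | succ n ih => rw [twoWord_succ, revIndex, ih]; rfl

lemma isAdm_oneWord {m : ℕ} (hm : 1 ≤ m) : IsAdm (oneWord m) := by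
  obtain ⟨m, rfl⟩ := Nat.exists_eq_add_of_le' hm
  exact ⟨valid_oneWord _, rfl⟩

lemma isAdm_twoWord {n : ℕ} (hn : 1 ≤ n) (m : ℕ) : IsAdm (twoWord n m) := by
  obtain ⟨n, rfl⟩ := Nat.exists_eq_add_of_le' hn
  exact ⟨valid_twoWord _ _, rfl⟩

/-- A sequence of functions moved up by one index, with `0` in front: the derivatives of a
sequence in which each function is the derivative of the next. -/
noncomputable def shiftIndex (f : ℕ → ℝ → ℝ) : ℕ → ℝ → ℝ
  | 0 => fun _ => 0
  | n + 1 => f n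

lemma hasDerivAt_Y_oneWord (k : ℕ) {θ : ℝ} (hθ : θ ∈ Ioo 0 Real.pi) :
    HasDerivAt (Y (oneWord k)) (shiftIndex (fun k => Y (oneWord k)) k θ) θ := by
  cases k with
  | zero =>
    refine (hasDerivAt_const θ (Real.pi / 2)).congr_of_eventuallyEq ?_
    filter_upwards [Ioo_mem_nhds hθ.1 hθ.2] with x hx
    exact Y_singleton_true hx
  | succ k => exact hasDerivAt_Y_false (oneWord_ne_nil k) hθ

/-- The bilinear part of `Y (twoWord n m)`, found by integrating by parts `n` times. -/
noncomputable def depthTwoMain (m n : ℕ) (θ : ℝ) : ℝ :=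
  ∑ i ∈ Finset.range (m + 1), (-1) ^ i * ((n + i).choose i : ℝ) *
    (Y (oneWord (m - i)) θ * X (oneWord (n + i)) θ)

/-- The remainder of `Y (twoWord n m)`; as `n` grows each is a primitive of the one before, and
the one for `n = 0` is constant (`hasDerivAt_depthTwoRest`). -/
noncomputable def depthTwoRest (m n : ℕ) (θ : ℝ) : ℝ := Y (twoWord n m) θ - depthTwoMain m n θ

/-- By Pascal's rule the two halves of the product rule telescope, up to `depthTwoMain m n`. -/
lemma hasDerivAt_depthTwoMain_succ (m n : ℕ) {θ : ℝ} (hθ : θ ∈ Ioo 0 Real.pi) :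
    HasDerivAt (depthTwoMain m (n + 1)) (depthTwoMain m n θ) θ := by
  have h := HasDerivAt.fun_sum (u := Finset.range (m + 1)) (x := θ)
    (A := fun i θ => (-1) ^ i * ((n + 1 + i).choose i : ℝ) *
      (Y (oneWord (m - i)) θ * X (oneWord (n + 1 + i)) θ))
    (A' := fun i => (-1) ^ i * ((n + 1 + i).choose i : ℝ) *
      (shiftIndex (fun k => Y (oneWord k)) (m - i) θ * X (oneWord (n + 1 + i)) θ +
        Y (oneWord (m - i)) θ * X (oneWord (n + i)) θ)) (fun i _ => by
      refine ((hasDerivAt_Y_oneWord (m - i) hθ).mul ?_).const_mul _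
      rw [show n + 1 + i = (n + i) + 1 by omega]
      exact hasDerivAt_X_false (oneWord_ne_nil _) hθ)
  convert! h using 1
  rw [depthTwoMain, ← sub_eq_zero, ← Finset.sum_sub_distrib, ← neg_eq_zero,
    ← Finset.sum_neg_distrib]
  set G : ℕ → ℝ := fun i => (-1) ^ i * ((n + 1 + i).choose i : ℝ) *
    (shiftIndex (fun k => Y (oneWord k)) (m - i) θ * X (oneWord (n + 1 + i)) θ) with hG
  set G' : ℕ → ℝ := fun i => match i with
    | 0 => 0
    | i + 1 => G i with hG'
  have hterm : ∀ i ∈ Finset.range (m + 1), -((-1) ^ i * ((n + i).choose i : ℝ) *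
      (Y (oneWord (m - i)) θ * X (oneWord (n + i)) θ) - (-1) ^ i * ((n + 1 + i).choose i : ℝ) *
      (shiftIndex (fun k => Y (oneWord k)) (m - i) θ * X (oneWord (n + 1 + i)) θ +
        Y (oneWord (m - i)) θ * X (oneWord (n + i)) θ)) = G i - G' i := by
    intro i hi
    rw [Finset.mem_range] at hi
    cases i with
    | zero => simp [hG, hG']
    | succ i =>
      have h1 : ((n + 1 + (i + 1)).choose (i + 1) : ℝ) =
          (n + 1 + i).choose i + (n + (i + 1)).choose (i + 1) := by
        rw [show n + 1 + (i + 1) = (n + 1 + i) + 1 by omega, Nat.choose_succ_succ]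
        rw [show n + (i + 1) = n + 1 + i by omega]
        push_cast; ring
      have h2 : shiftIndex (fun k => Y (oneWord k)) (m - i) θ = Y (oneWord (m - (i + 1))) θ := by
        rw [show m - i = (m - (i + 1)) + 1 by omega]; rfl
      simp only [hG, hG', h1, h2]
      rw [show n + 1 + i = n + (i + 1) by omega]
      ring
  rw [Finset.sum_congr rfl hterm, Finset.sum_sub_distrib, Finset.sum_range_succ,
    Finset.sum_range_succ' G']
  simp [hG, hG', shiftIndex]

lemma hasDerivAt_depthTwoMain_zero (m : ℕ) {θ : ℝ} (hθ : θ ∈ Ioo 0 Real.pi) :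
    HasDerivAt (depthTwoMain m 0) (-(Real.sin θ)⁻¹ * Y (oneWord m) θ) θ := by
  set x' : ℕ → ℝ := fun i => match i with
    | 0 => -(Real.sin θ)⁻¹
    | i + 1 => X (oneWord i) θ with hx'
  have hx : ∀ i, HasDerivAt (X (oneWord i)) (x' i) θ := by
    intro i
    cases i with
    | zero => simpa [hx', oneWord, X_nil] using hasDerivAt_X_true [] hθ
    | succ i => exact hasDerivAt_X_false (oneWord_ne_nil _) hθ
  have h := HasDerivAt.fun_sum (u := Finset.range (m + 1)) (x := θ)
    (A := fun i θ => (-1) ^ i * (Y (oneWord (m - i)) θ * X (oneWord i) θ))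
    (A' := fun i => (-1) ^ i * (shiftIndex (fun k => Y (oneWord k)) (m - i) θ * X (oneWord i) θ +
        Y (oneWord (m - i)) θ * x' i)) (fun i _ =>
      ((hasDerivAt_Y_oneWord (m - i) hθ).mul (hx i)).const_mul _)
  convert! h using 1
  · ext θ; simp [depthTwoMain]
  · simp only [mul_add]
    rw [Finset.sum_add_distrib, Finset.sum_range_succ, Finset.sum_range_succ' (fun i =>
      (-1) ^ i * (Y (oneWord (m - i)) θ * x' i))]
    have h2 : ∀ i ∈ Finset.range m,
        (-1) ^ i * (shiftIndex (fun k => Y (oneWord k)) (m - i) θ * X (oneWord i) θ) =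
        -((-1) ^ (i + 1) * (Y (oneWord (m - (i + 1))) θ * x' (i + 1))) := by
      intro i hi
      rw [Finset.mem_range] at hi
      have h2 : shiftIndex (fun k => Y (oneWord k)) (m - i) θ = Y (oneWord (m - (i + 1))) θ := by
        rw [show m - i = (m - (i + 1)) + 1 by omega]; rfl
      simp only [h2, hx']
      ring
    rw [Finset.sum_congr rfl h2, Finset.sum_neg_distrib]
    simp [shiftIndex, hx']
    ring

lemma hasDerivAt_depthTwoRest (m n : ℕ) {θ : ℝ} (hθ : θ ∈ Ioo 0 Real.pi) :
    HasDerivAt (depthTwoRest m n) (shiftIndex (depthTwoRest m) n θ) θ := by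
  cases n with
  | zero =>
    have := (hasDerivAt_Y_true (oneWord m) hθ).sub (hasDerivAt_depthTwoMain_zero m hθ)
    rwa [sub_self] at this
  | succ n =>
    exact (hasDerivAt_Y_false (twoWord_ne_nil n m) hθ).sub (hasDerivAt_depthTwoMain_succ m n hθ)

lemma depthTwoRest_pi_sub (m n : ℕ) {θ : ℝ} (hθ : θ ∈ Ioo 0 Real.pi) :
    depthTwoRest m n (Real.pi - θ) = -((-1) ^ (n + m) * depthTwoRest m n θ) := by
  have h : depthTwoMain m n (Real.pi - θ) = -((-1) ^ (n + m) * depthTwoMain m n θ) := by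
    rw [depthTwoMain, depthTwoMain, Finset.mul_sum, ← Finset.sum_neg_distrib]
    refine Finset.sum_congr rfl fun i hi => ?_
    rw [Finset.mem_range] at hi
    rw [Y_pi_sub (valid_oneWord _) hθ, X_pi_sub (valid_oneWord _) hθ, length_oneWord,
      length_oneWord]
    have h1 : (-1 : ℝ) ^ (m - i + 1) * (-1) ^ (n + i + 1) = (-1) ^ (n + m) := by
      rw [← pow_add, neg_one_pow_eq_pow_mod_two, neg_one_pow_eq_pow_mod_two (n + m)]
      congr 1; omega
    linear_combination (-((-1) ^ i * ((n + i).choose i : ℝ) *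
      (Y (oneWord (m - i)) θ * X (oneWord (n + i)) θ))) * h1
  rw [depthTwoRest, depthTwoRest, Y_pi_sub (valid_twoWord _ _) hθ, h, length_twoWord, pow_add _ _ 2]
  ring

/-- Bernoulli polynomials over factorials, rescaled to the interval `[0, π]`; each is the
derivative of the next. -/
noncomputable def bernoulliArc (l : ℕ) (θ : ℝ) : ℝ :=
  Real.pi ^ l / l.factorial * bernoulliFun l (θ / Real.pi)

lemma hasDerivAt_bernoulliArc (l : ℕ) (θ : ℝ) :
    HasDerivAt (bernoulliArc l) (shiftIndex bernoulliArc l θ) θ := by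
  have h := ((hasDerivAt_bernoulliFun l (θ / Real.pi)).comp θ
    ((hasDerivAt_id θ).div_const Real.pi)).const_mul (Real.pi ^ l / l.factorial)
  convert! h using 1
  have := Real.pi_ne_zero
  cases l with
  | zero => simp [shiftIndex]
  | succ l =>
    have h1 : (l.factorial : ℝ) ≠ 0 := by positivity
    have h2 : (l : ℝ) + 1 ≠ 0 := by positivity
    simp only [shiftIndex, bernoulliArc, Nat.factorial_succ, Nat.add_sub_cancel, pow_succ]
    push_cast
    field_simp

lemma bernoulliArc_pi_sub (l : ℕ) (θ : ℝ) :
    bernoulliArc l (Real.pi - θ) = (-1) ^ l * bernoulliArc l θ := by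
  rw [bernoulliArc, bernoulliArc, sub_div, div_self Real.pi_ne_zero, bernoulliFun_eval_one_sub]
  ring

lemma tendsto_bernoulliArc (l : ℕ) : Tendsto (bernoulliArc l) (𝓝[>] 0)
    (𝓝 (Real.pi ^ l / l.factorial * bernoulli l)) := by
  refine tendsto_nhdsWithin_of_tendsto_nhds ?_
  have h : ContinuousAt (bernoulliArc l) 0 := (hasDerivAt_bernoulliArc l 0).continuousAt
  rw [ContinuousAt] at h
  simpa only [bernoulliArc, zero_div, bernoulliFun_eval_zero] using h

/-- The derivative of the sum telescopes to `0`, and the sum is odd about `π / 2`. -/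
lemma sum_bernoulliArc_mul_depthTwoRest (m n : ℕ) (hmn : (n + m) % 2 = 1) {θ : ℝ}
    (hθ : θ ∈ Ioo 0 Real.pi) :
    ∑ j ∈ Finset.range (n + 2),
      (-1) ^ (n + 1 - j) * (bernoulliArc (n + 1 - j) θ * depthTwoRest m j θ) = 0 := by
  set H : ℝ → ℝ := fun θ => ∑ j ∈ Finset.range (n + 2),
      (-1) ^ (n + 1 - j) * (bernoulliArc (n + 1 - j) θ * depthTwoRest m j θ) with hH
  have hderiv : ∀ θ ∈ Ioo 0 Real.pi, HasDerivAt H 0 θ := by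
    intro θ hθ
    have h := HasDerivAt.fun_sum (u := Finset.range (n + 2)) (x := θ)
      (A := fun j θ => (-1) ^ (n + 1 - j) * (bernoulliArc (n + 1 - j) θ * depthTwoRest m j θ))
      (A' := fun j => (-1) ^ (n + 1 - j) * (shiftIndex bernoulliArc (n + 1 - j) θ * depthTwoRest m j θ +
          bernoulliArc (n + 1 - j) θ * shiftIndex (depthTwoRest m) j θ)) (fun j _ =>
        ((hasDerivAt_bernoulliArc _ θ).mul (hasDerivAt_depthTwoRest m j hθ)).const_mul _)
    convert! h using 1
    simp only [mul_add]
    rw [Finset.sum_add_distrib, Finset.sum_range_succ, Finset.sum_range_succ' (fun j =>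
      (-1) ^ (n + 1 - j) * (bernoulliArc (n + 1 - j) θ * shiftIndex (depthTwoRest m) j θ))]
    have h2 : ∀ j ∈ Finset.range (n + 1),
        (-1) ^ (n + 1 - j) * (shiftIndex bernoulliArc (n + 1 - j) θ * depthTwoRest m j θ) =
        -((-1) ^ (n + 1 - (j + 1)) *
          (bernoulliArc (n + 1 - (j + 1)) θ * shiftIndex (depthTwoRest m) (j + 1) θ)) := by
      intro j hj
      rw [Finset.mem_range] at hj
      rw [show n + 1 - j = (n + 1 - (j + 1)) + 1 by omega]
      simp only [shiftIndex, pow_succ]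
      ring
    rw [Finset.sum_congr rfl h2, Finset.sum_neg_distrib]
    simp [shiftIndex]
  have hodd : ∀ θ ∈ Ioo 0 Real.pi, H (Real.pi - θ) = -H θ := by
    intro θ hθ
    simp only [hH]
    rw [← Finset.sum_neg_distrib]
    refine Finset.sum_congr rfl fun j hj => ?_
    rw [Finset.mem_range] at hj
    rw [bernoulliArc_pi_sub, depthTwoRest_pi_sub m j hθ]
    have h1 : (-1 : ℝ) ^ (n + 1 - j) * (-1) ^ (j + m) = 1 := by
      rw [← pow_add, neg_one_pow_eq_pow_mod_two, show (n + 1 - j + (j + m)) % 2 = 0 by omega,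
        pow_zero]
    linear_combination (-((-1) ^ (n + 1 - j) *
      (bernoulliArc (n + 1 - j) θ * depthTwoRest m j θ))) * h1
  have hθ' : Real.pi - θ ∈ Ioo 0 Real.pi := ⟨by linarith [hθ.2], by linarith [hθ.1]⟩
  have hconst := isOpen_Ioo.is_const_of_deriv_eq_zero isPreconnected_Ioo
    (fun θ hθ => (hderiv θ hθ).differentiableAt.differentiableWithinAt)
    (fun θ hθ => (hderiv θ hθ).deriv) hθ hθ'
  have := hodd θ hθ
  change H θ = 0
  linarith

lemma tendsto_X_oneWord {k : ℕ} (hk : 1 ≤ k) :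
    Tendsto (X (oneWord k)) (𝓝[>] 0) (𝓝 (((-Complex.I) ^ k).re * T [k + 1])) := by
  have := tendsto_X (isAdm_oneWord hk)
  rwa [count_oneWord, revIndex_oneWord, List.reverse_singleton] at this

lemma tendsto_Y_oneWord_zero : Tendsto (Y (oneWord 0)) (𝓝[>] 0) (𝓝 (Real.pi / 2)) := by
  refine tendsto_const_nhds.congr' ?_
  filter_upwards [Ioo_mem_nhdsGT Real.pi_pos] with θ hθ
  exact (Y_singleton_true hθ).symm

lemma tendsto_Y_oneWord {k : ℕ} (hk : 1 ≤ k) :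
    Tendsto (Y (oneWord k)) (𝓝[>] 0) (𝓝 (((-Complex.I) ^ k).im * T [k + 1])) := by
  have := tendsto_Y (isAdm_oneWord hk)
  rwa [count_oneWord, revIndex_oneWord, List.reverse_singleton] at this

lemma tendsto_Y_twoWord {n : ℕ} (hn : 1 ≤ n) (m : ℕ) : Tendsto (Y (twoWord n m)) (𝓝[>] 0)
    (𝓝 (((-Complex.I) ^ (n + m)).im * T [m + 1, n + 1])) := by
  have := tendsto_Y (isAdm_twoWord hn m)
  rwa [count_twoWord, revIndex_twoWord, List.reverse_cons, List.reverse_singleton] at this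

/-- For even weight `Y (twoWord n m)` tends to `0`, and in `depthTwoMain` only the last summand
survives. -/
lemma tendsto_depthTwoRest_even {m n k : ℕ} (hn : 1 ≤ n) (hk : n + m = 2 * k) :
    Tendsto (depthTwoRest m n) (𝓝[>] 0)
      (𝓝 (-((-1) ^ m * ((n + m).choose m : ℝ) * (Real.pi / 2 * ((-1) ^ k * T [n + m + 1]))))) := by
  have h1 := tendsto_Y_twoWord hn m
  rw [im_neg_I_pow (by omega), zero_mul] at h1
  have h2 : Tendsto (depthTwoMain m n) (𝓝[>] 0)
      (𝓝 ((-1) ^ m * ((n + m).choose m : ℝ) * (Real.pi / 2 * ((-1) ^ k * T [n + m + 1])))) := by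
    unfold depthTwoMain
    simp only [Finset.sum_range_succ, Nat.sub_self]
    rw [← zero_add ((-1) ^ m * ((n + m).choose m : ℝ) * _)]
    refine Tendsto.add ?_ ?_
    · have h4 : Tendsto (fun θ => ∑ i ∈ Finset.range m, (-1) ^ i * ((n + i).choose i : ℝ) *
          (Y (oneWord (m - i)) θ * X (oneWord (n + i)) θ)) (𝓝[>] 0)
          (𝓝 (∑ i ∈ Finset.range m, 0)) := by
        refine tendsto_finsetSum _ fun i hi => ?_
        rw [Finset.mem_range] at hi
        have h3 := ((tendsto_Y_oneWord (k := m - i) (by omega)).mul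
          (tendsto_X_oneWord (k := n + i) (by omega))).const_mul ((-1) ^ i * ((n + i).choose i : ℝ))
        convert! h3 using 2
        rcases Nat.mod_two_eq_zero_or_one (n + i) with h | h
        · rw [im_neg_I_pow (a := m - i) (by omega)]; ring
        · rw [re_neg_I_pow h]; ring
      rwa [Finset.sum_const_zero] at h4
    · refine (tendsto_Y_oneWord_zero.mul ?_).const_mul _
      have := tendsto_X_oneWord (k := n + m) (by omega)
      rw [hk, re_neg_I_pow_even] at this
      rwa [hk]
  rw [← zero_sub]
  exact h1.sub h2

/-- For odd weight `Y (twoWord n m)` tends to `± T(m + 1, n + 1)`. -/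
lemma tendsto_depthTwoRest_odd {m n k : ℕ} (hn : 1 ≤ n) (hk : n + m = 2 * k + 1) :
    Tendsto (depthTwoRest m n) (𝓝[>] 0) (𝓝 (-((-1) ^ k * (T [m + 1, n + 1] + (-1) ^ m *
      ∑ μ ∈ (Finset.range m).filter (fun μ => μ % 2 = (m + 1) % 2),
        ((n + μ).choose μ : ℝ) * T [m + 1 - μ] * T [n + 1 + μ])))) := by
  have h1 := tendsto_Y_twoWord hn m
  rw [hk, im_neg_I_pow_odd] at h1
  have h2 : Tendsto (depthTwoMain m n) (𝓝[>] 0) (𝓝 ((-1) ^ k * ((-1) ^ m *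
      ∑ μ ∈ (Finset.range m).filter (fun μ => μ % 2 = (m + 1) % 2),
        ((n + μ).choose μ : ℝ) * T [m + 1 - μ] * T [n + 1 + μ]))) := by
    unfold depthTwoMain
    simp only [Finset.sum_range_succ, Nat.sub_self]
    rw [← add_zero ((-1 : ℝ) ^ k * _), Finset.sum_filter, ← mul_assoc, Finset.mul_sum]
    refine Tendsto.add (tendsto_finsetSum _ fun i hi => ?_) ?_
    · rw [Finset.mem_range] at hi
      have h3 := ((tendsto_Y_oneWord (k := m - i) (by omega)).mul
        (tendsto_X_oneWord (k := n + i) (by omega))).const_mul ((-1) ^ i * ((n + i).choose i : ℝ))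
      convert! h3 using 2
      split_ifs with h
      · obtain ⟨a, ha⟩ : ∃ a, m - i = 2 * a + 1 := ⟨(m - i) / 2, by omega⟩
        obtain ⟨b, hb⟩ : ∃ b, n + i = 2 * b := ⟨(n + i) / 2, by omega⟩
        have hab : k = a + b := by omega
        have hm : (-1 : ℝ) ^ m = -(-1) ^ i := by
          rw [show m = (2 * a + 1) + i by omega, pow_add, pow_succ, pow_mul]; simp
        rw [ha, im_neg_I_pow_odd, ← ha, hb, re_neg_I_pow_even, ← hb, hab, hm, pow_add,
          show m - i + 1 = m + 1 - i by omega, show n + i + 1 = n + 1 + i by omega]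
        ring
      · rw [re_neg_I_pow (a := n + i) (by omega)]; ring
    · have h3 := (tendsto_Y_oneWord_zero.mul (tendsto_X_oneWord (k := n + m) (by omega))).const_mul
        ((-1) ^ m * ((n + m).choose m : ℝ))
      rw [re_neg_I_pow (a := n + m) (by omega)] at h3
      simpa using h3
  convert! h1.sub h2 using 2
  ring

lemma depthTwoRest_zero_of_even {m : ℕ} (hm : m % 2 = 0) {θ : ℝ} (hθ : θ ∈ Ioo 0 Real.pi) :
    depthTwoRest m 0 θ = 0 := by
  have hθ' : Real.pi - θ ∈ Ioo 0 Real.pi := ⟨by linarith [hθ.2], by linarith [hθ.1]⟩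
  have hconst := isOpen_Ioo.is_const_of_deriv_eq_zero isPreconnected_Ioo
    (fun θ hθ => (hasDerivAt_depthTwoRest m 0 hθ).differentiableAt.differentiableWithinAt)
    (fun θ hθ => (hasDerivAt_depthTwoRest m 0 hθ).deriv) hθ hθ'
  have h := depthTwoRest_pi_sub m 0 hθ
  rw [zero_add, neg_one_pow_eq_pow_mod_two, hm, pow_zero] at h
  linarith

lemma tendsto_bernoulliArc_mul {m n j k : ℕ} (hj : 1 ≤ j) (hjn : j < n) (hk : n + m = 2 * k + 1) :
    Tendsto (fun θ => (-1) ^ (n + 1 - j) * (bernoulliArc (n + 1 - j) θ * depthTwoRest m j θ))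
      (𝓝[>] 0) (𝓝 (-((-1) ^ k * (-1) ^ m * (Real.pi / 2)) * if j % 2 = (n + 1) % 2 then
        ((m + j).choose j : ℝ) * (1 / ((2 : ℝ) ^ (n + 1 - j) - 1)) * T [m + 1 + j] * T [n + 1 - j]
        else 0)) := by
  by_cases hpar : j % 2 = (n + 1) % 2
  · rw [if_pos hpar]
    obtain ⟨s, hs⟩ : ∃ s, n + 1 - j = 2 * s := ⟨(n + 1 - j) / 2, by omega⟩
    obtain ⟨c, hc⟩ : ∃ c, j + m = 2 * c := ⟨(j + m) / 2, by omega⟩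
    have h := ((tendsto_bernoulliArc (n + 1 - j)).mul (tendsto_depthTwoRest_even hj hc)).const_mul
      ((-1) ^ (n + 1 - j))
    convert! h using 2
    have hB := T_even (l := s) (by omega)
    have h1 : (-1 : ℝ) ^ k = (-1) ^ (s + 1) * (-1) ^ c := by
      rw [← pow_add, neg_one_pow_eq_pow_mod_two, neg_one_pow_eq_pow_mod_two (s + 1 + c)]
      congr 1; omega
    have h2 : (-1 : ℝ) ^ (s + 1) * (-1) ^ (s + 1) = 1 := by rw [← mul_pow]; simp
    have h3 : (m + j).choose j = (j + m).choose m := by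
      rw [add_comm m j, Nat.choose_symm_add]
    rw [hs, h1, h3, show m + 1 + j = j + m + 1 by omega, (even_two_mul s).neg_one_pow]
    have h4 : 1 / ((2 : ℝ) ^ (2 * s) - 1) * T [j + m + 1] * T [2 * s] =
        T [j + m + 1] * (T [2 * s] / (2 ^ (2 * s) - 1)) := by ring
    rw [mul_assoc (((j + m).choose m : ℝ) * _), mul_assoc ((j + m).choose m : ℝ),
      ← mul_assoc _ _ (T [2 * s]), h4, hB]
    linear_combination (-((-1) ^ c * (-1) ^ m * (Real.pi / 2) * ((j + m).choose m : ℝ) *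
      T [j + m + 1] * Real.pi ^ (2 * s) * (bernoulli (2 * s) : ℝ) / (2 * s).factorial)) * h2
  · rw [if_neg hpar, mul_zero]
    obtain ⟨c, hc⟩ : ∃ c, j + m = 2 * c + 1 := ⟨(j + m) / 2, by omega⟩
    have h := ((tendsto_bernoulliArc (n + 1 - j)).mul (tendsto_depthTwoRest_odd hj hc)).const_mul
      ((-1) ^ (n + 1 - j))
    rw [bernoulli_eq_zero_of_odd (Nat.odd_iff.2 (by omega)) (by omega)] at h
    simpa using h

theorem T_depth_two {m n : ℕ} (hn : 1 ≤ n) (hmn : (n + m) % 2 = 1) :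
    (-1 : ℝ) ^ m * T [m + 1, n + 1] = ((n + m + 1).choose m : ℝ) * T [n + m + 2] -
      ∑ μ ∈ (Finset.Ico 1 n).filter (fun μ => μ % 2 = (n + 1) % 2),
        ((m + μ).choose μ : ℝ) * (1 / ((2 : ℝ) ^ (n + 1 - μ) - 1)) * T [m + 1 + μ] * T [n + 1 - μ] -
      ∑ μ ∈ (Finset.range m).filter (fun μ => μ % 2 = (m + 1) % 2),
        ((n + μ).choose μ : ℝ) * T [m + 1 - μ] * T [n + 1 + μ] := by
  obtain ⟨k, hk⟩ : ∃ k, n + m = 2 * k + 1 := ⟨(n + m) / 2, by omega⟩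
  have hpi := Real.pi_pos
  have h0 : Tendsto (fun θ => (-1) ^ (n + 1 - 0) * (bernoulliArc (n + 1 - 0) θ *
      depthTwoRest m 0 θ)) (𝓝[>] 0) (𝓝 0) := by
    obtain ⟨c, hc⟩ := exists_eq_add_const (f := depthTwoRest m 0) (g := fun _ => 0)
      (h := fun _ => 0) (fun θ hθ => hasDerivAt_depthTwoRest m 0 hθ)
      (fun θ _ => hasDerivAt_const θ 0)
    have h : Tendsto (depthTwoRest m 0) (𝓝[>] 0) (𝓝 c) := by
      refine tendsto_const_nhds.congr' ?_
      filter_upwards [Ioo_mem_nhdsGT Real.pi_pos] with θ hθ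
      rw [hc θ hθ, zero_add]
    have h' := ((tendsto_bernoulliArc (n + 1 - 0)).mul h).const_mul ((-1) ^ (n + 1 - 0))
    convert! h' using 2
    rcases Nat.mod_two_eq_zero_or_one m with hm | hm
    · have hhalf : Real.pi / 2 ∈ Ioo 0 Real.pi := ⟨by positivity, by linarith⟩
      have hc0 : c = 0 := by
        have := hc _ hhalf
        rw [depthTwoRest_zero_of_even hm hhalf] at this
        linarith
      rw [hc0]; ring
    · rw [bernoulli_eq_zero_of_odd (Nat.odd_iff.2 (by omega)) (by omega)]
      simp
  have h1 := tendsto_finsetSum (Finset.Ico 1 n) (fun j hj =>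
    tendsto_bernoulliArc_mul (m := m) (k := k) (Finset.mem_Ico.1 hj).1 (Finset.mem_Ico.1 hj).2 hk)
  have h2 : Tendsto (fun θ => (-1) ^ (n + 1 - n) * (bernoulliArc (n + 1 - n) θ *
      depthTwoRest m n θ)) (𝓝[>] 0) (𝓝 (Real.pi / 2 * -((-1) ^ k * (T [m + 1, n + 1] + (-1) ^ m *
      ∑ μ ∈ (Finset.range m).filter (fun μ => μ % 2 = (m + 1) % 2),
        ((n + μ).choose μ : ℝ) * T [m + 1 - μ] * T [n + 1 + μ])))) := by
    have h := ((tendsto_bernoulliArc (n + 1 - n)).mul (tendsto_depthTwoRest_odd hn hk)).const_mul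
      ((-1) ^ (n + 1 - n))
    convert! h using 2
    rw [show n + 1 - n = 1 by omega, bernoulli_one]
    push_cast
    simp only [Nat.factorial_one, Nat.cast_one]
    ring
  have h3 : Tendsto (fun θ => (-1) ^ (n + 1 - (n + 1)) * (bernoulliArc (n + 1 - (n + 1)) θ *
      depthTwoRest m (n + 1) θ)) (𝓝[>] 0)
      (𝓝 ((-1) ^ m * (-1) ^ k * (Real.pi / 2) * ((n + m + 1).choose m * T [n + m + 2]))) := by
    have h := ((tendsto_bernoulliArc (n + 1 - (n + 1))).mul (tendsto_depthTwoRest_even (m := m)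
      (n := n + 1) (k := k + 1) (by omega) (by omega))).const_mul ((-1) ^ (n + 1 - (n + 1)))
    convert! h using 2
    rw [Nat.sub_self, bernoulli_zero, show n + 1 + m = n + m + 1 by omega]
    push_cast
    simp only [Nat.factorial_zero, Nat.cast_one]
    ring
  have hsum := ((h0.add h1).add h2).add h3
  have hz := tendsto_nhds_unique (hsum.congr' (by
    filter_upwards [Ioo_mem_nhdsGT Real.pi_pos] with θ hθ
    have := sum_bernoulliArc_mul_depthTwoRest m n hmn hθ
    rw [Finset.sum_range_succ, Finset.sum_range_succ, Finset.range_eq_Ico,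
      Finset.sum_eq_sum_Ico_succ_bot (by omega)] at this
    exact this)) tendsto_const_nhds
  rw [← Finset.mul_sum, ← Finset.sum_filter] at hz
  refine mul_left_cancel₀ (half_pos hpi).ne' ?_
  rcases neg_one_pow_eq_or ℝ m with hm | hm <;> rcases neg_one_pow_eq_or ℝ k with hk' | hk' <;>
    rw [hm, hk'] at hz <;> rw [hm] <;> first | linear_combination hz | linear_combination -hz

end

end MTV


theorem theorem5 :
    (∀ k : List ℕ, MTV.Admissible k → 2 ≤ MTV.depth k →
      ¬ (MTV.depth k ≡ MTV.weight k [MOD 2]) →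
      MTV.T k ∈ Submodule.span ℚ
        (MTV.lowerDepthValues (MTV.depth k) ∪ MTV.productValues (MTV.depth k))) ∧
    (∀ p q : ℕ, 1 ≤ p → 2 ≤ q → Odd (p + q) →
      (-1 : ℝ) ^ q * MTV.T [p, q] =
        ((p + q - 1).choose q : ℝ) * MTV.T [p + q]
        - ∑ μ ∈ (Finset.Ico 1 (q - 1)).filter (fun μ => μ ≡ q [MOD 2]),
            ((p + μ - 1).choose μ : ℝ) * (1 / ((2 : ℝ) ^ (q - μ) - 1)) *
              MTV.T [p + μ] * MTV.T [q - μ]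
        - ∑ μ ∈ (Finset.Ico 0 (p - 1)).filter (fun μ => μ ≡ p [MOD 2]),
            ((q + μ - 1).choose μ : ℝ) * MTV.T [p - μ] * MTV.T [q + μ]) := by
  refine ⟨fun k hk hd hpar => MTV.T_mem_span hk hd hpar, fun p q hp hq hodd => ?_⟩
  obtain ⟨m, rfl⟩ := Nat.exists_eq_add_of_le' hp
  obtain ⟨n, rfl⟩ := Nat.exists_eq_add_of_le' (show 1 ≤ q by omega)
  rw [Nat.odd_iff] at hodd
  have h := MTV.T_depth_two (m := m) (n := n) (by omega) (by omega)
  have h1 : (-1 : ℝ) ^ (n + 1) = (-1) ^ m := by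
    rw [neg_one_pow_eq_pow_mod_two, neg_one_pow_eq_pow_mod_two m]
    congr 1; omega
  have h2 : (m + 1 + (n + 1) - 1).choose (n + 1) = (n + m + 1).choose m := by
    rw [show m + 1 + (n + 1) - 1 = m + (n + 1) by omega, ← Nat.choose_symm_add]
    congr 1; omega
  have h3 : ∀ μ, m + 1 + μ - 1 = m + μ := fun μ => by omega
  have h4 : ∀ μ, n + 1 + μ - 1 = n + μ := fun μ => by omega
  rw [h1, h2, h, show m + 1 + (n + 1) = n + m + 2 by omega]
  simp only [h3, h4, Nat.add_sub_cancel, Nat.ModEq, Finset.range_eq_Ico]
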